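/- Conventions. An enhanced 2-category is a (strict) 2-category $\mathcal K$ with a class of *tight* 1-cells containing the identities and closed under composition. A *left-tight pullback* is a strict 2-pullback whose left leg is tight and detects tightness (if $p\circ h$ is tight then so is $h$). A *discrete opfibration* is a 1-cell $p:E\to B$ such that every 2-cell $\varphi : p e\Rightarrow b$ lifts to a unique 2-cell $e\Rightarrow e'$. $\mathcal K$ is a *plumbus* if it has a terminal object (in the 2-categorical sense) with tight maps into it, and left-tight pullbacks of tight discrete opfibrations along arbitrary 1-cells. A class of *small* discrete opfibrations is a replete class of tight discrete opfibrations, stable under left-tight pullback and containing $\mathrm{id}_1$. A *2-classifier* is a small discrete opfibration $u:\Omega_\bullet\to\Omega$ such that for all $B$ the functor $f\mapsto f^*u$ from $\mathcal K(B,\Omega)$ to tight discrete opfibrations over $B$ is fully faithful, with the small ones as essential image; $f$ is a *classifying map* of $p$ if $p$ is a left-tight pullback of $u$ along $f$. An *enhanced 2-monad* $(T,i,m)$ is a 2-monad such that $T$ preserves tight 1-cells and $i,m$ have tight components. $\mathrm{Alg}_{\mathrm{lx}}(T)$ is the enhanced 2-category of strict $T$-algebras with tight structure map, lax $T$-morphisms,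 and $T$-2-morphisms; its tight 1-cells are the strict $T$-morphisms with tight underlying 1-cell. Let $\mathcal K$ be a plumbus with a class of small discrete opfibrations and a 2-classifier $u:\Omega_\bullet\to\Omega$, and let $(T,i,m)$ be an enhanced 2-monad on $\mathcal K$ such that: $Tu$ is small; $T$ sends left-tight pullbacks of $u$ to 2-pullbacks; the naturality squares of $i$ and $m$ at $u$ are 2-pullbacks; $Tu$ has a tight classifying map $\omega:T\Omega\to\Omega$, with corresponding map $\omega_\bullet:T\Omega_\bullet\to\Omega_\bullet$ over it; and $(\Omega,\omega)$ is a strict $T$-algebra. Let $(X,\xi)$ and $(B,\beta)$ be strict $T$-algebras with tight structure maps, let $b:X\to B$ be a colax $T$-morphism with colaxator $\bar b: b\,\xi\Rightarrow \beta\, Tb$, and let $b/B$ be a comma object of $b$ and $\mathrm{id}_B$ in $\mathcal K$, with universal 2-cell $\chi: b\,\partial_0\Rightarrow\partial_1$, such that $\partial_1:b/B\to B$ is a small discrete opfibration. Let $\bar b/\beta:T(b/B)\to b/B$ be the 1-cell induced by the universal property from $\xi\,T\partial_0$, $\beta\,T\partial_1$ and the 2-cell $(\beta\, T\chi)\cdot(\bar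 b\,T\partial_0)$. The algebra $B$ is *$T$-cartesian at $b$* if $\partial_1:(b/B,\bar b/\beta)\to(B,\beta)$ is $T$-cartesian, i.e. the comparison $\delta$ from $T(b/B)$ to the pullback of $\partial_1$ along $\beta$ induced by $\bar b/\beta$ and $T\partial_1$ is a split equivalence: there is $s$ with $\delta s=\mathrm{id}$ and $s\delta\cong\mathrm{id}$. Then $(\Omega_\bullet,\omega_\bullet)$ and $(b/B,\bar b/\beta)$ are strict $T$-algebras with tight structure maps, $u$ and $\partial_1$ are strict $T$-morphisms, and $\partial_1$ is a tight discrete opfibration in $\mathrm{Alg}_{\mathrm{lx}}(T)$. Moreover, let $B(b,-):B\to\Omega$ be any classifying map of $\partial_1$ in $\mathcal K$, exhibited by a left-tight pullback square with top side $e:b/B\to\Omega_\bullet$. Then: 1. there is exactly one lax $T$-morphism structure on $B(b,-):(B,\beta)\to(\Omega,\omega)$ for which, with a suitable lax $T$-morphism structure on $e$, the square is a left-tight pullback in $\mathrm{Alg}_{\mathrm{lx}}(T)$ (that is, $B(b,-)$ is a lax $T$-morphism, the one classifying $\partial_1$ in $\mathrm{Alg}_{\mathrm{lx}}(T)$); 2.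 with this structure, $B(b,-)$ is a pseudo $T$-morphism (its laxator is invertible) if and only if $B$ is $T$-cartesian at $b$. -/

import Mathlib

/-! Enhanced 2-categories, classifiers for discrete opfibrations, and algebras of enhanced 2-monads.

2-categories are strict bicategories, and `f ≫ g` is composition in diagrammatic order.  Equations
between 2-cells whose boundaries are equal 1-cells, but not syntactically the same ones, are written
with heterogeneous equality `≍`; wherever it occurs, the two sides have provably equal sources and
provably equal targets. -/

open CategoryTheory Bicategory

universe w v u

/-! ### Enhanced 2-categories and their limits -/

/-- The enhancement of a 2-category: a class of *tight* 1-cells that contains the identities and is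
closed under composition (a wide and locally full sub-2-category). -/
class Enhanced (K : Type u) [Bicategory.{w, v} K] where
  tight : ∀ {A B : K}, (A ⟶ B) → Prop
  tight_id : ∀ A : K, tight (𝟙 A)
  tight_comp : ∀ {A B C : K} (f : A ⟶ B) (g : B ⟶ C), tight f → tight g → tight (f ≫ g)

section Limits

variable {K : Type u} [Bicategory.{w, v} K] [Strict K]

/-- The square `p ≫ f = q ≫ g` is a strict 2-pullback. -/
structure IsTwoPullback {P A D C : K} (p : P ⟶ A) (q : P ⟶ D) (f : A ⟶ C) (g : D ⟶ C) :
    Prop where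
  comm : p ≫ f = q ≫ g
  lift : ∀ {Z : K} (x : Z ⟶ A) (y : Z ⟶ D), x ≫ f = y ≫ g →
    ∃! h : Z ⟶ P, h ≫ p = x ∧ h ≫ q = y
  lift₂ : ∀ {Z : K} (h k : Z ⟶ P) (θ : h ≫ p ⟶ k ≫ p) (ψ : h ≫ q ⟶ k ≫ q),
    θ ▷ f ≍ ψ ▷ g → ∃! χ : h ⟶ k, χ ▷ p = θ ∧ χ ▷ q = ψ

/-- `p : E ⟶ B` is a discrete opfibration: every 2-cell `φ : e ≫ p ⟶ b` has a unique lift to a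
2-cell `e ⟶ e'`. -/
def IsDiscreteOpfibration {E B : K} (p : E ⟶ B) : Prop :=
  ∀ {X : K} (e : X ⟶ E) (b : X ⟶ B) (φ : e ≫ p ⟶ b),
    ∃! l : (e' : X ⟶ E) × (e ⟶ e'), l.1 ≫ p = b ∧ l.2 ▷ p ≍ φ

/-- A comma object of `b : X ⟶ B` over the identity of `B`, that is, the universal 2-cell
`cell : dom ≫ b ⟶ cod` out of `b`.  Its vertex is `b / B`, and `cod` is the representable discrete
opfibration `∂₁ : b / B ⟶ B`. -/
structure RepComma {X B : K} (b : X ⟶ B) where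
  pt : K
  dom : pt ⟶ X
  cod : pt ⟶ B
  cell : dom ≫ b ⟶ cod
  lift : ∀ {Z : K} (x : Z ⟶ X) (y : Z ⟶ B) (ψ : x ≫ b ⟶ y),
    ∃! h : Z ⟶ pt, h ≫ dom = x ∧ h ≫ cod = y ∧ h ◁ cell ≍ ψ
  lift₂ : ∀ {Z : K} (h k : Z ⟶ pt) (θ : h ≫ dom ⟶ k ≫ dom) (ψ : h ≫ cod ⟶ k ≫ cod),
    θ ▷ b ≫ (α_ k dom b).hom ≫ k ◁ cell = (α_ h dom b).hom ≫ h ◁ cell ≫ ψ →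
    ∃! χ : h ⟶ k, χ ▷ dom = θ ∧ χ ▷ cod = ψ

/-- A split equivalence: `d` has a strict section `s`, and `d ≫ s` is isomorphic to the identity. -/
def IsSplitEquivalence {A B : K} (d : A ⟶ B) : Prop :=
  ∃ s : B ⟶ A, s ≫ d = 𝟙 B ∧ Nonempty (d ≫ s ≅ 𝟙 A)

variable [Enhanced K]

/-- A left-tight pullback: a strict 2-pullback whose left leg `p` is tight and detects
tightness. -/
structure IsLeftTightPullback {P A D C : K} (p : P ⟶ A) (q : P ⟶ D) (f : A ⟶ C) (g : D ⟶ C) :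
    Prop extends IsTwoPullback p q f g where
  tight_left : Enhanced.tight p
  detects : ∀ {Z : K} (h : Z ⟶ P), Enhanced.tight (h ≫ p) → Enhanced.tight h

def IsTightDiscreteOpfibration {E B : K} (p : E ⟶ B) : Prop :=
  Enhanced.tight p ∧ IsDiscreteOpfibration p

/-- A tight terminal object: `K(X, t)` is the terminal category for every `X`, and the unique
1-cells `X ⟶ t` are tight. -/
structure IsTightTerminal (t : K) : Prop where
  exists_tight : ∀ X : K, ∃ f : X ⟶ t, Enhanced.tight f
  hom_eq : ∀ {X : K} (f g : X ⟶ t), f = g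
  cell_eq : ∀ {X : K} {f g : X ⟶ t} (θ ψ : f ⟶ g), θ = ψ

variable (K) in
/-- A plumbus: an enhanced 2-category with a tight terminal object and with left-tight pullbacks of
tight discrete opfibrations along arbitrary 1-cells. -/
structure IsPlumbus : Prop where
  exists_terminal : ∃ t : K, IsTightTerminal t
  exists_pullback : ∀ {E B A : K} (p : E ⟶ B) (f : A ⟶ B), IsTightDiscreteOpfibration p →
    ∃ (P : K) (p' : P ⟶ A) (q : P ⟶ E), IsLeftTightPullback p' q f p

variable (K) in
/-- A pullback-ideal of tight discrete opfibrations, called *small*: a replete class of tight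
discrete opfibrations that is stable under left-tight pullback and contains the identity of a
terminal object. -/
structure PullbackIdeal where
  small : ∀ {E B : K}, (E ⟶ B) → Prop
  isTightDiscreteOpfibration : ∀ {E B : K} (p : E ⟶ B), small p → IsTightDiscreteOpfibration p
  pullback : ∀ {P A E B : K} (p' : P ⟶ A) (q : P ⟶ E) (f : A ⟶ B) (p : E ⟶ B),
    IsLeftTightPullback p' q f p → small p → small p'
  replete : ∀ {E E' B : K} (p : E ⟶ B) (p' : E' ⟶ B) (k : E ⟶ E') (l : E' ⟶ E),
    k ≫ l = 𝟙 E → l ≫ k = 𝟙 E' → k ≫ p' = p →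
    small p → IsTightDiscreteOpfibration p' → small p'
  id_terminal : ∀ t : K, IsTightTerminal t → small (𝟙 t)

/-- Let `p : E ⟶ B` and `p' : E' ⟶ B` be the pullbacks of `u` along `f, g : B ⟶ Ω`, with top sides
`e` and `e'`.  The functor `(-)^* u` sends the 2-cell `φ : f ⟶ g` to the unique `k : E ⟶ E'` over
`B` for which the lift of `p ◁ φ` along `u` starting at `e` ends at `k ≫ e'`.  This says that `k` is
that 1-cell. -/
def IsPullbackOfCell {Ωp Ω B E E' : K} (u : Ωp ⟶ Ω) {f g : B ⟶ Ω} (p : E ⟶ B) (e : E ⟶ Ωp)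
    (p' : E' ⟶ B) (e' : E' ⟶ Ωp) (φ : f ⟶ g) (k : E ⟶ E') : Prop :=
  k ≫ p' = p ∧ ∃ l : e ⟶ k ≫ e', l ▷ u ≍ p ◁ φ

/-- `u : Ωp ⟶ Ω` is a 2-classifier for small discrete opfibrations: it is small, and the functors
`(-)^* u` from `K(B, Ω)` to tight discrete opfibrations over `B` are fully faithful, with essential
image the small ones. -/
structure PullbackIdeal.IsTwoClassifier (S : PullbackIdeal K) {Ωp Ω : K} (u : Ωp ⟶ Ω) :
    Prop where
  small : S.small u
  classify : ∀ {E B : K} (p : E ⟶ B), S.small p →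
    ∃ (f : B ⟶ Ω) (e : E ⟶ Ωp), IsLeftTightPullback p e f u
  fullyFaithful : ∀ {B E E' : K} (f g : B ⟶ Ω) (p : E ⟶ B) (e : E ⟶ Ωp) (p' : E' ⟶ B)
    (e' : E' ⟶ Ωp), IsLeftTightPullback p e f u → IsLeftTightPullback p' e' g u →
    ∀ k : E ⟶ E', k ≫ p' = p → ∃! φ : f ⟶ g, IsPullbackOfCell u p e p' e' φ k

end Limits

/-! ### Auxiliary facts on equality of 2-cells up to equality of their boundaries -/

section Whiskering

variable {K : Type u} [Bicategory.{w, v} K]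

theorem whiskerLeft_congr_left {A B C : K} {f f' : A ⟶ B} {g h : B ⟶ C} (θ : g ⟶ h)
    (hf : f = f') :
    f ◁ θ = eqToHom (by rw [hf]) ≫ f' ◁ θ ≫ eqToHom (by rw [hf]) := by
  subst hf; simp

theorem whiskerRight_congr_right {A B C : K} {f g : A ⟶ B} {h h' : B ⟶ C} (θ : f ⟶ g)
    (hh : h = h') :
    θ ▷ h = eqToHom (by rw [hh]) ≫ θ ▷ h' ≫ eqToHom (by rw [hh]) := by
  subst hh; simp

variable [Strict K]

theorem comp_whiskerLeft_eqToHom {A B C D : K} (f : A ⟶ B) (g : B ⟶ C) {h k : C ⟶ D}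
    (θ : h ⟶ k) :
    (f ≫ g) ◁ θ = eqToHom (Strict.assoc f g h) ≫ f ◁ g ◁ θ ≫
      eqToHom (Strict.assoc f g k).symm := by
  simp [Strict.associator_eqToIso]

theorem whiskerRight_comp_eqToHom {A B C D : K} {f g : A ⟶ B} (θ : f ⟶ g) (h : B ⟶ C)
    (k : C ⟶ D) :
    θ ▷ (h ≫ k) = eqToHom (Strict.assoc f h k).symm ≫ θ ▷ h ▷ k ≫
      eqToHom (Strict.assoc g h k) := by
  simp [Strict.associator_eqToIso]

theorem whisker_assoc_eqToHom {A B C D : K} (f : A ⟶ B) {g h : B ⟶ C} (θ : g ⟶ h) (k : C ⟶ D) :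
    (f ◁ θ) ▷ k = eqToHom (Strict.assoc f g k) ≫ f ◁ θ ▷ k ≫
      eqToHom (Strict.assoc f h k).symm := by
  simp [Strict.associator_eqToIso]

theorem id_whiskerLeft_eqToHom {A B : K} {f g : A ⟶ B} (θ : f ⟶ g) :
    𝟙 A ◁ θ = eqToHom (Strict.id_comp f) ≫ θ ≫ eqToHom (Strict.id_comp g).symm := by
  simp [Strict.leftUnitor_eqToIso]

theorem whiskerRight_id_eqToHom {A B : K} {f g : A ⟶ B} (θ : f ⟶ g) :
    θ ▷ 𝟙 B = eqToHom (Strict.comp_id f) ≫ θ ≫ eqToHom (Strict.comp_id g).symm := by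
  simp [Strict.rightUnitor_eqToIso]

theorem StrictPseudofunctor.map₂_whiskerLeft' (T : StrictPseudofunctor K K) {A B C : K}
    (f : A ⟶ B) {g h : B ⟶ C} (θ : g ⟶ h) :
    T.map₂ (f ◁ θ) = eqToHom (T.map_comp f g) ≫ T.map f ◁ T.map₂ θ ≫
      eqToHom (T.map_comp f h).symm := by
  simp [T.mapComp_eq_eqToIso]

theorem StrictPseudofunctor.map₂_whiskerRight' (T : StrictPseudofunctor K K) {A B C : K}
    {f g : A ⟶ B} (θ : f ⟶ g) (h : B ⟶ C) :
    T.map₂ (θ ▷ h) = eqToHom (T.map_comp f h) ≫ T.map₂ θ ▷ T.map h ≫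
      eqToHom (T.map_comp g h).symm := by
  simp [T.mapComp_eq_eqToIso]

end Whiskering

/-! ### Enhanced 2-monads and their algebras -/

section Monads

variable (K : Type u) [Bicategory.{w, v} K] [Strict K] [Enhanced K]

/-- An enhanced 2-monad: a strict 2-functor `T` that preserves tightness, with 2-natural unit and
multiplication that have tight components and satisfy the monad laws. -/
structure EnhancedTwoMonad extends StrictPseudofunctor K K where
  map_tight : ∀ {A B : K} (f : A ⟶ B), Enhanced.tight f → Enhanced.tight (map f)
  i : ∀ A : K, A ⟶ obj A
  m : ∀ A : K, obj (obj A) ⟶ obj A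
  i_tight : ∀ A : K, Enhanced.tight (i A)
  m_tight : ∀ A : K, Enhanced.tight (m A)
  i_naturality : ∀ {A B : K} (f : A ⟶ B), i A ≫ map f = f ≫ i B
  m_naturality : ∀ {A B : K} (f : A ⟶ B), m A ≫ map f = map (map f) ≫ m B
  i_naturality₂ : ∀ {A B : K} {f g : A ⟶ B} (θ : f ⟶ g), i A ◁ map₂ θ ≍ θ ▷ i B
  m_naturality₂ : ∀ {A B : K} {f g : A ⟶ B} (θ : f ⟶ g),
    m A ◁ map₂ θ ≍ map₂ (map₂ θ) ▷ m B
  i_m : ∀ A : K, i (obj A) ≫ m A = 𝟙 (obj A)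
  map_i_m : ∀ A : K, map (i A) ≫ m A = 𝟙 (obj A)
  m_m : ∀ A : K, m (obj A) ≫ m A = map (m A) ≫ m A

end Monads

section Algebras

variable {K : Type u} [Bicategory.{w, v} K] [Strict K] [Enhanced K]

namespace EnhancedTwoMonad

/-- `a : T A ⟶ A` is a tight 1-cell that makes `A` a strict `T`-algebra. -/
structure IsAlgebra (T : EnhancedTwoMonad K) {A : K} (a : T.obj A ⟶ A) : Prop where
  tight : Enhanced.tight a
  unit : T.i A ≫ a = 𝟙 A
  assoc : T.m A ≫ a = T.map a ≫ a

/-- Objects of the enhanced 2-category `Alg_lx(T)`: strict `T`-algebras with tight structure map. -/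
structure AlgLx (T : EnhancedTwoMonad K) where
  carrier : K
  str : T.obj carrier ⟶ carrier
  isAlgebra : T.IsAlgebra str

variable {T : EnhancedTwoMonad K}

/-- A lax `T`-morphism: a (loose) 1-cell with a laxator satisfying the unit and multiplication
axioms. -/
@[ext]
structure LaxHom (A B : AlgLx T) where
  map : A.carrier ⟶ B.carrier
  lax : T.map map ≫ B.str ⟶ A.str ≫ map
  lax_unit : T.i A.carrier ◁ lax ≍ 𝟙 map
  lax_mult : T.m A.carrier ◁ lax ≍
    T.map₂ lax ▷ B.str ≫ eqToHom (by simp [T.map_comp]) ≫ T.map A.str ◁ lax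

/-- A colax `T`-morphism: a (loose) 1-cell with a colaxator satisfying the unit and multiplication
axioms. -/
structure ColaxHom (A B : AlgLx T) where
  map : A.carrier ⟶ B.carrier
  colax : A.str ≫ map ⟶ T.map map ≫ B.str
  colax_unit : T.i A.carrier ◁ colax ≍ 𝟙 map
  colax_mult : T.m A.carrier ◁ colax ≍
    T.map A.str ◁ colax ≫ eqToHom (by simp [T.map_comp]) ≫ T.map₂ colax ▷ B.str

/-- A lax `T`-morphism is pseudo when its laxator is invertible. -/
def LaxHom.IsPseudo {A B : AlgLx T} (f : LaxHom A B) : Prop := IsIso f.lax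

/-- A `T`-2-morphism of lax `T`-morphisms. -/
@[ext]
structure LaxHom.Cell {A B : AlgLx T} (f g : LaxHom A B) where
  cell : f.map ⟶ g.map
  comm : T.map₂ cell ▷ B.str ≫ g.lax = f.lax ≫ A.str ◁ cell

/-! #### The 2-category structure of `Alg_lx(T)` -/

instance (A B : AlgLx T) : Category (LaxHom A B) where
  Hom f g := LaxHom.Cell f g
  id f := ⟨𝟙 _, by simp⟩
  comp θ ψ := ⟨θ.cell ≫ ψ.cell, by
    rw [T.map₂_comp, comp_whiskerRight, Category.assoc, ψ.comm, ← Category.assoc, θ.comm,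
      Category.assoc, whiskerLeft_comp]⟩

@[simp] theorem LaxHom.id_cell {A B : AlgLx T} (f : LaxHom A B) :
    LaxHom.Cell.cell (𝟙 f) = 𝟙 f.map := rfl

@[simp] theorem LaxHom.comp_cell {A B : AlgLx T} {f g h : LaxHom A B} (θ : f ⟶ g) (ψ : g ⟶ h) :
    LaxHom.Cell.cell (θ ≫ ψ) = LaxHom.Cell.cell θ ≫ LaxHom.Cell.cell ψ := rfl

@[ext] theorem LaxHom.hom_ext {A B : AlgLx T} {f g : LaxHom A B} {θ ψ : f ⟶ g}
    (h : LaxHom.Cell.cell θ = LaxHom.Cell.cell ψ) : θ = ψ := LaxHom.Cell.ext h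

/-- A 1-cell that strictly commutes with the structure maps, as a lax `T`-morphism. -/
def LaxHom.ofStrict {A B : AlgLx T} (f : A.carrier ⟶ B.carrier)
    (hf : T.map f ≫ B.str = A.str ≫ f) : LaxHom A B where
  map := f
  lax := eqToHom hf
  lax_unit := by
    rw [whiskerLeft_eqToHom]
    refine (eqToHom_heq_id_cod _ _ _).trans ?_
    rw [← Strict.assoc, A.isAlgebra.unit, Strict.id_comp]
  lax_mult := by
    simp only [whiskerLeft_eqToHom, PrelaxFunctor.map₂_eqToHom, eqToHom_whiskerRight,
      eqToHom_trans]
    refine (eqToHom_heq_id_cod _ _ _).trans ((?_ : HEq _ _).trans (eqToHom_heq_id_cod _ _ _).symm)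
    rw [← Strict.assoc, A.isAlgebra.assoc, Strict.assoc]

def LaxHom.id (A : AlgLx T) : LaxHom A A :=
  LaxHom.ofStrict (𝟙 A.carrier) (by rw [T.map_id, Strict.id_comp, Strict.comp_id])

theorem LaxHom.lax_unit' {A B : AlgLx T} (f : LaxHom A B) :
    T.i A.carrier ◁ f.lax = eqToHom (by
      rw [← Strict.assoc, T.i_naturality, Strict.assoc, B.isAlgebra.unit, Strict.comp_id,
        ← Strict.assoc, A.isAlgebra.unit, Strict.id_comp]) := by
  apply eq_of_heq
  refine f.lax_unit.trans (HEq.trans ?_ (eqToHom_heq_id_cod _ _ _).symm)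
  rw [← Strict.assoc, A.isAlgebra.unit, Strict.id_comp]

theorem LaxHom.lax_mult' {A B : AlgLx T} (f : LaxHom A B) :
    T.m A.carrier ◁ f.lax = eqToHom (by
        rw [← Strict.assoc, T.m_naturality, T.map_comp, Strict.assoc, Strict.assoc,
          B.isAlgebra.assoc]) ≫
      (T.map₂ f.lax ▷ B.str ≫ eqToHom (by simp [T.map_comp]) ≫ T.map A.str ◁ f.lax) ≫
      eqToHom (by rw [← Strict.assoc, ← Strict.assoc, A.isAlgebra.assoc]) :=
  (conj_eqToHom_iff_heq' _ _ _ _).2 f.lax_mult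

/-- Composition of lax `T`-morphisms. -/
def LaxHom.comp {A B C : AlgLx T} (f : LaxHom A B) (g : LaxHom B C) : LaxHom A C where
  map := f.map ≫ g.map
  lax := eqToHom (by rw [T.map_comp, Strict.assoc]) ≫ T.map f.map ◁ g.lax ≫
    eqToHom (Strict.assoc _ _ _).symm ≫ f.lax ▷ g.map ≫ eqToHom (Strict.assoc _ _ _)
  lax_unit := by
    have h1 := whiskerLeft_congr_left g.lax (T.i_naturality f.map)
    rw [comp_whiskerLeft_eqToHom, comp_whiskerLeft_eqToHom, g.lax_unit'] at h1
    have h2 := whisker_assoc_eqToHom (T.i A.carrier) f.lax g.map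
    rw [f.lax_unit'] at h2
    simp only [whiskerLeft_eqToHom, eqToHom_whiskerRight, eqToHom_trans] at h1 h2
    rw [eqToHom_comp_iff, comp_eqToHom_iff] at h1
    rw [eq_comm, eqToHom_comp_iff, comp_eqToHom_iff] at h2
    simp only [whiskerLeft_comp, whiskerLeft_eqToHom, h1, h2, eqToHom_trans]
    refine (eqToHom_heq_id_cod _ _ _).trans ?_
    rw [← Strict.assoc, A.isAlgebra.unit, Strict.id_comp]
  lax_mult := by
    have h1 := whiskerLeft_congr_left g.lax (T.m_naturality f.map)
    rw [comp_whiskerLeft_eqToHom, comp_whiskerLeft_eqToHom, g.lax_mult'] at h1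
    rw [eqToHom_comp_iff, comp_eqToHom_iff] at h1
    have h2 := whisker_assoc_eqToHom (T.m A.carrier) f.lax g.map
    rw [f.lax_mult', eq_comm, eqToHom_comp_iff, comp_eqToHom_iff] at h2
    have h3 := whisker_exchange (T.map₂ f.lax) g.lax
    rw [whiskerLeft_congr_left g.lax (T.map_comp (T.map f.map) B.str),
      whiskerLeft_congr_left g.lax (T.map_comp A.str f.map)] at h3
    simp only [comp_whiskerLeft_eqToHom, whiskerRight_comp_eqToHom, Category.assoc,
      eqToHom_trans_assoc, eqToHom_trans] at h3
    rw [eqToHom_comp_iff] at h3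
    refine (conj_eqToHom_iff_heq' _ _ ?_ ?_).1 ?_
    · rw [← Strict.assoc, T.m_naturality]
      simp [T.map_comp, C.isAlgebra.assoc]
    · rw [← Strict.assoc (T.m A.carrier), A.isAlgebra.assoc, Strict.assoc]
    simp only [whiskerLeft_comp, comp_whiskerRight, h1, h2, whiskerLeft_eqToHom, T.map₂_comp,
      eqToHom_whiskerRight, PrelaxFunctor.map₂_eqToHom, whisker_assoc_eqToHom,
      StrictPseudofunctor.map₂_whiskerLeft', StrictPseudofunctor.map₂_whiskerRight',
      Category.assoc, eqToHom_trans, eqToHom_trans_assoc]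
    have h4 := congrArg (fun t => T.map (T.map f.map) ◁ T.map₂ g.lax ▷ C.str ≫
      eqToHom (by simp [T.map_comp]) ≫ t ≫ eqToHom (by simp [T.map_comp]) ≫
        T.map A.str ◁ f.lax ▷ g.map) h3
    simp only [Category.assoc, eqToHom_trans_assoc] at h4
    simp only [reassoc_of% h4]

def LaxHom.whiskerLeft {A B C : AlgLx T} (f : LaxHom A B) {g h : LaxHom B C} (θ : g ⟶ h) :
    f.comp g ⟶ f.comp h where
  cell := f.map ◁ LaxHom.Cell.cell θ
  comm := by
    have h1 := congrArg (fun t => T.map f.map ◁ t) (LaxHom.Cell.comm θ)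
    simp only [whiskerLeft_comp] at h1
    have h2 := whisker_exchange f.lax (LaxHom.Cell.cell θ)
    simp only [comp_whiskerLeft_eqToHom, Category.assoc] at h2
    rw [eqToHom_comp_iff] at h2
    simp only [LaxHom.comp, StrictPseudofunctor.map₂_whiskerLeft', comp_whiskerRight,
      eqToHom_whiskerRight, whisker_assoc_eqToHom, Category.assoc, eqToHom_trans_assoc,
      eqToHom_refl, Category.id_comp]
    rw [reassoc_of% h1]
    simp only [reassoc_of% h2, eqToHom_trans, eqToHom_refl, Category.comp_id]

def LaxHom.whiskerRight {A B C : AlgLx T} {f g : LaxHom A B} (θ : f ⟶ g) (h : LaxHom B C) :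
    f.comp h ⟶ g.comp h where
  cell := LaxHom.Cell.cell θ ▷ h.map
  comm := by
    have h1 := congrArg (fun t => t ▷ h.map) (LaxHom.Cell.comm θ)
    simp only [comp_whiskerRight, whisker_assoc_eqToHom] at h1
    have h2 := whisker_exchange (T.map₂ (LaxHom.Cell.cell θ)) h.lax
    simp only [whiskerRight_comp_eqToHom, Category.assoc] at h2
    rw [eq_comm, eqToHom_comp_iff] at h2
    have h3 := congrArg (fun t => t ≫ eqToHom (Strict.assoc A.str g.map h.map)) h1
    simp only [Category.assoc, eqToHom_trans, eqToHom_refl, Category.comp_id] at h3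
    simp only [LaxHom.comp, StrictPseudofunctor.map₂_whiskerRight', comp_whiskerRight,
      eqToHom_whiskerRight, Category.assoc, eqToHom_trans_assoc, reassoc_of% h2,
      eqToHom_refl, Category.id_comp, h3]

@[simp] theorem LaxHom.whiskerLeft_cell {A B C : AlgLx T} (f : LaxHom A B) {g h : LaxHom B C}
    (θ : g ⟶ h) :
    LaxHom.Cell.cell (LaxHom.whiskerLeft f θ) = f.map ◁ LaxHom.Cell.cell θ := rfl

@[simp] theorem LaxHom.whiskerRight_cell {A B C : AlgLx T} {f g : LaxHom A B} (θ : f ⟶ g)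
    (h : LaxHom B C) :
    LaxHom.Cell.cell (LaxHom.whiskerRight θ h) = LaxHom.Cell.cell θ ▷ h.map := rfl

theorem LaxHom.ext_eqToHom {A B : AlgLx T} {f g : LaxHom A B} (h : f.map = g.map)
    (hl : f.lax = eqToHom (by rw [h]) ≫ g.lax ≫ eqToHom (by rw [h])) : f = g := by
  cases f; cases g; cases h
  simp only [eqToHom_refl, Category.id_comp, Category.comp_id] at hl
  cases hl; rfl

theorem LaxHom.id_comp' {A B : AlgLx T} (f : LaxHom A B) : (LaxHom.id A).comp f = f := by
  refine LaxHom.ext_eqToHom (Strict.id_comp _) ?_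
  simp only [LaxHom.comp, LaxHom.id, LaxHom.ofStrict,
    whiskerLeft_congr_left f.lax (T.map_id A.carrier), id_whiskerLeft_eqToHom,
    eqToHom_whiskerRight, Category.assoc, eqToHom_trans, eqToHom_trans_assoc]

theorem LaxHom.comp_id' {A B : AlgLx T} (f : LaxHom A B) : f.comp (LaxHom.id B) = f := by
  refine LaxHom.ext_eqToHom (Strict.comp_id _) ?_
  simp only [LaxHom.comp, LaxHom.id, LaxHom.ofStrict, whiskerRight_id_eqToHom,
    whiskerLeft_eqToHom, Category.assoc, eqToHom_trans, eqToHom_trans_assoc]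

theorem LaxHom.assoc' {A B C D : AlgLx T} (f : LaxHom A B) (g : LaxHom B C) (h : LaxHom C D) :
    (f.comp g).comp h = f.comp (g.comp h) := by
  refine LaxHom.ext (Strict.assoc _ _ _) ?_
  simp only [LaxHom.comp, whiskerLeft_congr_left h.lax (T.map_comp f.map g.map),
    comp_whiskerLeft_eqToHom, whiskerRight_comp_eqToHom, whisker_assoc_eqToHom,
    comp_whiskerRight, whiskerLeft_comp, whiskerLeft_eqToHom, eqToHom_whiskerRight,
    Category.assoc, eqToHom_trans, eqToHom_trans_assoc]
  refine (conj_eqToHom_iff_heq' _ _ ?_ ?_).1 ?_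
  · simp [T.map_comp]
  · simp
  simp only [Category.assoc, eqToHom_trans, eqToHom_trans_assoc]

@[simp] theorem LaxHom.eqToHom_cell {A B : AlgLx T} {f g : LaxHom A B} (h : f = g) :
    LaxHom.Cell.cell (eqToHom h) = eqToHom (congrArg LaxHom.map h) := by
  subst h; rfl

instance : Bicategory (AlgLx T) where
  Hom A B := LaxHom A B
  id A := LaxHom.id A
  comp f g := LaxHom.comp f g
  whiskerLeft f _ _ θ := LaxHom.whiskerLeft f θ
  whiskerRight θ h := LaxHom.whiskerRight θ h
  associator f g h := eqToIso (LaxHom.assoc' f g h)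
  leftUnitor f := eqToIso (LaxHom.id_comp' f)
  rightUnitor f := eqToIso (LaxHom.comp_id' f)
  whiskerLeft_id f g := by
    ext; exact whiskerLeft_id f.map g.map
  whiskerLeft_comp f _ _ _ θ ψ := by
    ext; exact whiskerLeft_comp f.map θ.cell ψ.cell
  id_whiskerLeft θ := by
    ext; simp only [LaxHom.comp_cell, eqToIso.hom, eqToIso.inv, LaxHom.eqToHom_cell]
    exact id_whiskerLeft_eqToHom θ.cell
  comp_whiskerLeft f g _ _ θ := by
    ext; simp only [LaxHom.comp_cell, eqToIso.hom, eqToIso.inv, LaxHom.eqToHom_cell]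
    exact comp_whiskerLeft_eqToHom f.map g.map θ.cell
  id_whiskerRight f g := by
    ext; exact id_whiskerRight f.map g.map
  comp_whiskerRight θ ψ f := by
    ext; exact comp_whiskerRight θ.cell ψ.cell f.map
  whiskerRight_id θ := by
    ext; simp only [LaxHom.comp_cell, eqToIso.hom, eqToIso.inv, LaxHom.eqToHom_cell]
    exact whiskerRight_id_eqToHom θ.cell
  whiskerRight_comp θ f g := by
    ext; simp only [LaxHom.comp_cell, eqToIso.hom, eqToIso.inv, LaxHom.eqToHom_cell]
    exact whiskerRight_comp_eqToHom θ.cell f.map g.map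
  whisker_assoc f _ _ θ h := by
    ext; simp only [LaxHom.comp_cell, eqToIso.hom, eqToIso.inv, LaxHom.eqToHom_cell]
    exact whisker_assoc_eqToHom f.map θ.cell h.map
  whisker_exchange θ ψ := by
    ext; exact whisker_exchange θ.cell ψ.cell
  pentagon f g h k := by
    ext
    have := pentagon f.map g.map h.map k.map
    simp only [Strict.associator_eqToIso, eqToIso.hom] at this
    simpa only [LaxHom.comp_cell, eqToIso.hom, LaxHom.eqToHom_cell, LaxHom.whiskerLeft_cell,
      LaxHom.whiskerRight_cell] using! this
  triangle f g := by
    ext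
    have := triangle f.map g.map
    simp only [Strict.associator_eqToIso, Strict.leftUnitor_eqToIso, Strict.rightUnitor_eqToIso,
      eqToIso.hom] at this
    simpa only [LaxHom.comp_cell, eqToIso.hom, LaxHom.eqToHom_cell, LaxHom.whiskerLeft_cell,
      LaxHom.whiskerRight_cell] using! this

instance : Strict (AlgLx T) where
  id_comp := LaxHom.id_comp'
  comp_id := LaxHom.comp_id'
  assoc := LaxHom.assoc'
  leftUnitor_eqToIso _ := rfl
  rightUnitor_eqToIso _ := rfl
  associator_eqToIso _ _ _ := rfl

/-- The tight 1-cells of `Alg_lx(T)` are the strict `T`-morphisms whose underlying 1-cell is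
tight. -/
instance : Enhanced (AlgLx T) where
  tight {A B} f := Enhanced.tight (LaxHom.map f) ∧
    ∃ h : T.map (LaxHom.map f) ≫ B.str = A.str ≫ LaxHom.map f, LaxHom.lax f = eqToHom h
  tight_id A := ⟨Enhanced.tight_id A.carrier, by
    change T.map (𝟙 A.carrier) ≫ _ = _ ≫ 𝟙 A.carrier
    rw [T.map_id, Strict.id_comp, Strict.comp_id], rfl⟩
  tight_comp f g hf hg := by
    obtain ⟨hf, ef, hf'⟩ := hf
    obtain ⟨hg, eg, hg'⟩ := hg
    refine ⟨Enhanced.tight_comp _ _ hf hg, ?_, ?_⟩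
    · change T.map (f.map ≫ g.map) ≫ _ = _ ≫ f.map ≫ g.map
      rw [T.map_comp, Strict.assoc, eg, ← Strict.assoc, ef, Strict.assoc]
    · change LaxHom.lax (LaxHom.comp f g) = _
      simp only [LaxHom.comp, hf', hg', whiskerLeft_eqToHom, eqToHom_whiskerRight, eqToHom_trans]
      rfl

/-! #### Cartesian morphisms and the lifting hypotheses -/

variable (T) in
/-- A strict morphism `f` from `(A, a)` to `(B, b)` is `T`-cartesian: its defect, the comparison `d`
from `T A` to the pullback of `f` and `b`, is a split equivalence. -/
def IsCartesian {A B : K} (a : T.obj A ⟶ A) (b : T.obj B ⟶ B) (f : A ⟶ B) : Prop :=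
  T.map f ≫ b = a ≫ f ∧
    ∃ (P : K) (p : P ⟶ A) (q : P ⟶ T.obj B) (d : T.obj A ⟶ P),
      IsTwoPullback p q f b ∧ d ≫ p = a ∧ d ≫ q = T.map f ∧ IsSplitEquivalence d

section Comma

variable {X B : AlgLx T} (b : ColaxHom X B) (C : RepComma b.map)

/-- The pasting of `T` of the comma cell with the colaxator of `b`. -/
def ColaxHom.commaCell :
    (T.map C.dom ≫ X.str) ≫ b.map ⟶ T.map C.cod ≫ B.str :=
  (α_ _ _ _).hom ≫ T.map C.dom ◁ b.colax ≫
    eqToHom (by rw [← Strict.assoc, ← T.map_comp]) ≫ T.map₂ C.cell ▷ B.str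

/-- The structure map `T (b / B) ⟶ b / B` induced by the colaxator of `b`, that is, by the creation
of the comma object `b / B` in the 2-category of algebras and colax morphisms. -/
noncomputable def ColaxHom.commaStr : T.obj C.pt ⟶ C.pt :=
  (C.lift (T.map C.dom ≫ X.str) (T.map C.cod ≫ B.str) (b.commaCell C)).choose

theorem ColaxHom.commaStr_spec : b.commaStr C ≫ C.dom = T.map C.dom ≫ X.str ∧
    b.commaStr C ≫ C.cod = T.map C.cod ≫ B.str ∧ b.commaStr C ◁ C.cell ≍ b.commaCell C :=
  (C.lift (T.map C.dom ≫ X.str) (T.map C.cod ≫ B.str) (b.commaCell C)).choose_spec.1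

/-- The algebra `B` is `T`-cartesian at the colax morphism `b`: the representable discrete
opfibration `∂₁ : b / B ⟶ B` is a `T`-cartesian morphism. -/
def ColaxHom.IsCartesianAt : Prop :=
  ∃ C : RepComma b.map, T.IsCartesian (b.commaStr C) B.str C.cod

end Comma

/-- The hypotheses for lifting the 2-classifier `u` to `T`-algebras: `T u` is small and is
classified by a tight 1-cell `ω` (with top side `ωp`) that makes `Ω` a strict `T`-algebra, `T`
preserves pullbacks of `u`, and the unit and multiplication of `T` are cartesian at `u`. -/
structure LiftsClassifier (T : EnhancedTwoMonad K) (S : PullbackIdeal K) {Ωp Ω : K} (u : Ωp ⟶ Ω)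
    (ωp : T.obj Ωp ⟶ Ωp) (ω : T.obj Ω ⟶ Ω) : Prop where
  small : S.small (T.map u)
  map_pullback : ∀ {E B : K} (p : E ⟶ B) (e : E ⟶ Ωp) (f : B ⟶ Ω),
    IsLeftTightPullback p e f u → IsTwoPullback (T.map p) (T.map e) (T.map f) (T.map u)
  i_cartesian : IsTwoPullback u (T.i Ωp) (T.i Ω) (T.map u)
  m_cartesian : IsTwoPullback (T.map (T.map u)) (T.m Ωp) (T.m Ω) (T.map u)
  classifies : IsLeftTightPullback (T.map u) ωp ω u
  isAlgebra : T.IsAlgebra ω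

end EnhancedTwoMonad

end Algebras

/-! Full faithfulness of `f ↦ f^* u` is used as a universal property. If `p` is classified by `x`
with top side `e`, a square `p ≫ y = e' ≫ u` is the same thing as a morphism from `p` to `y^* u`
over the base. It therefore comes from exactly one pair of 2-cells `x ⟶ y` and `e ⟶ e'` such that
the second lies over the first whiskered with `p` (`exists_cell` and `cell_ext` in
`PullbackIdeal.IsTwoClassifier`).

Let `p` be a strict morphism of algebras with classifying map `f`. Pasting `T` of its classifying
square with that of `T u` shows that `T p` is classified by `T f ≫ ω`
(`LiftsClassifier.isLeftTightPullback`). The structure maps form a square from `T p` to `p`, and the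
universal property turns it into a 2-cell `T f ≫ ω ⟶ B.str ≫ f`. This is the laxator, and it brings
a laxator for `e` with it. Its unit and multiplication axioms and its uniqueness are the uniqueness
clause for `p`, `T T p` and `T p` (`LiftsClassifier.wl_i`, `LiftsClassifier.wl_m`, `mainTheorem3`).

By full faithfulness the laxator is invertible exactly when the morphism from `T p` to the pullback
of `p` along `B.str` is invertible, i.e. when the structure square is a 2-pullback. The
weaker-looking split equivalence in the definition of `T`-cartesian suffices because `T p` is a
discrete opfibration (`IsCartesian.isTwoPullback`).

Limits and opfibrations pass to algebras because a laxator over a strict discrete opfibration is a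
unique lift, so its axioms hold as soon as they hold downstairs (`LaxHom.exists_of_comp`). The
algebra laws for `ωp` follow from `exists_point`: the domain of `u` is reached from a single point
by a 2-cell. Those for the comma object follow from its universal property.

All equations are between 2-cells bundled with their boundaries, so that strict coherence becomes
rewriting. -/

/-! ### Bundled 2-cells -/

section BundledCells

variable {K : Type u} [Bicategory.{w, v} K]

/-- A 2-cell bundled with its boundary. -/
@[ext]
structure TwoCell (A B : K) where
  src : A ⟶ B
  tgt : A ⟶ B
  cell : src ⟶ tgt

namespace TwoCell

def of {A B : K} {f g : A ⟶ B} (θ : f ⟶ g) : TwoCell A B := ⟨f, g, θ⟩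

/-- Left whiskering. -/
def wl {A B C : K} (f : A ⟶ B) (c : TwoCell B C) : TwoCell A C := of (f ◁ c.cell)

/-- Right whiskering. -/
def wr {A B C : K} (c : TwoCell A B) (g : B ⟶ C) : TwoCell A C := of (c.cell ▷ g)

open Classical in
/-- Vertical composition, which is only meaningful when the boundaries match. -/
noncomputable def vcomp {A B : K} (c d : TwoCell A B) : TwoCell A B :=
  -- The fallback `c` makes the source of a composite equal to that of `c` in every case, so
  -- `vcomp_src` needs no hypothesis.
  if h : c.tgt = d.src then of (c.cell ≫ eqToHom h ≫ d.cell) else c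

infixr:80 " ⊚ " => TwoCell.vcomp

variable {A B C D : K}

@[simp] theorem of_src {f g : A ⟶ B} (θ : f ⟶ g) : (of θ).src = f := rfl
@[simp] theorem of_tgt {f g : A ⟶ B} (θ : f ⟶ g) : (of θ).tgt = g := rfl
@[simp] theorem of_cell {f g : A ⟶ B} (θ : f ⟶ g) : (of θ).cell = θ := rfl
@[simp] theorem wl_src (f : A ⟶ B) (c : TwoCell B C) : (c.wl f).src = f ≫ c.src := rfl
@[simp] theorem wl_tgt (f : A ⟶ B) (c : TwoCell B C) : (c.wl f).tgt = f ≫ c.tgt := rfl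
@[simp] theorem wr_src (c : TwoCell A B) (g : B ⟶ C) : (c.wr g).src = c.src ≫ g := rfl
@[simp] theorem wr_tgt (c : TwoCell A B) (g : B ⟶ C) : (c.wr g).tgt = c.tgt ≫ g := rfl

theorem of_inj {f g : A ⟶ B} {θ ψ : f ⟶ g} : of θ = of ψ ↔ θ = ψ :=
  ⟨fun h => by simpa [of] using h, fun h => h ▸ rfl⟩

/-- The bridge to the heterogeneous equations in the definitions: once the boundaries are known to
agree, these become plain equations of bundled cells. -/
theorem of_eq_iff_heq {f g f' g' : A ⟶ B} {θ : f ⟶ g} {ψ : f' ⟶ g'} (hf : f = f') (hg : g = g') :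
    of θ = of ψ ↔ θ ≍ ψ := by
  subst hf hg; simp [of_inj]

theorem heq_of_of_eq {f g f' g' : A ⟶ B} {θ : f ⟶ g} {ψ : f' ⟶ g'} (h : of θ = of ψ) : θ ≍ ψ :=
  (of_eq_iff_heq (congrArg src h) (congrArg tgt h)).1 h

theorem exists_of {f g : A ⟶ B} (c : TwoCell A B) (hf : c.src = f) (hg : c.tgt = g) :
    ∃ θ : f ⟶ g, of θ = c := by
  subst hf hg; exact ⟨c.cell, rfl⟩

-- With the next two lemmas, this makes the coherence cells of a strict 2-category disappear after
-- bundling.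
@[simp] theorem of_eqToHom {f g : A ⟶ B} (h : f = g) : of (eqToHom h) = of (𝟙 f) := by
  subst h; rfl

@[simp] theorem of_eqToHom_comp {f g h : A ⟶ B} (e : f = g) (θ : g ⟶ h) :
    of (eqToHom e ≫ θ) = of θ := by
  subst e; simp

@[simp] theorem of_comp_eqToHom {f g h : A ⟶ B} (θ : f ⟶ g) (e : g = h) :
    of (θ ≫ eqToHom e) = of θ := by
  subst e; simp

@[simp] theorem of_whiskerLeft (f : A ⟶ B) {g h : B ⟶ C} (θ : g ⟶ h) :
    of (f ◁ θ) = (of θ).wl f := rfl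

@[simp] theorem of_whiskerRight {f g : A ⟶ B} (θ : f ⟶ g) (h : B ⟶ C) :
    of (θ ▷ h) = (of θ).wr h := rfl

@[simp] theorem of_comp {f g h : A ⟶ B} (θ : f ⟶ g) (ψ : g ⟶ h) :
    of (θ ≫ ψ) = of θ ⊚ of ψ := by
  have h : (of θ).tgt = (of ψ).src := rfl
  rw [vcomp, dif_pos h]
  exact congrArg of (congrArg (θ ≫ ·) (Category.id_comp ψ).symm)

@[simp] theorem vcomp_src (c d : TwoCell A B) : (c ⊚ d).src = c.src := by
  unfold vcomp; split <;> rfl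

theorem vcomp_tgt {c d : TwoCell A B} (h : c.tgt = d.src) : (c ⊚ d).tgt = d.tgt := by
  rw [vcomp, dif_pos h]; rfl

theorem vcomp_assoc {c d e : TwoCell A B} (h : c.tgt = d.src) (h' : d.tgt = e.src) :
    (c ⊚ d) ⊚ e = c ⊚ d ⊚ e := by
  obtain ⟨a, b, θ⟩ := c
  obtain ⟨b', c, ψ⟩ := d
  obtain ⟨c', d, χ⟩ := e
  obtain rfl : b = b' := h
  obtain rfl : c = c' := h'
  change (of θ ⊚ of ψ) ⊚ of χ = of θ ⊚ of ψ ⊚ of χ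
  simp only [← of_comp, Category.assoc]

theorem id_vcomp {c : TwoCell A B} {f : A ⟶ B} (h : c.src = f) : of (𝟙 f) ⊚ c = c := by
  subst h
  obtain ⟨a, b, θ⟩ := c
  change of (𝟙 a) ⊚ of θ = of θ
  rw [← of_comp, Category.id_comp]

theorem vcomp_id {c : TwoCell A B} {f : A ⟶ B} (h : c.tgt = f) : c ⊚ of (𝟙 f) = c := by
  subst h
  obtain ⟨a, b, θ⟩ := c
  change of θ ⊚ of (𝟙 b) = of θ
  rw [← of_comp, Category.comp_id]

theorem wl_vcomp (f : A ⟶ B) {c d : TwoCell B C} (h : c.tgt = d.src) :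
    (c ⊚ d).wl f = c.wl f ⊚ d.wl f := by
  obtain ⟨a, b, θ⟩ := c
  obtain ⟨b', c, ψ⟩ := d
  obtain rfl : b = b' := h
  change (of θ ⊚ of ψ).wl f = (of θ).wl f ⊚ (of ψ).wl f
  simp only [← of_comp, ← of_whiskerLeft, whiskerLeft_comp]

theorem wr_vcomp {c d : TwoCell A B} (h : c.tgt = d.src) (g : B ⟶ C) :
    (c ⊚ d).wr g = c.wr g ⊚ d.wr g := by
  obtain ⟨a, b, θ⟩ := c
  obtain ⟨b', c, ψ⟩ := d
  obtain rfl : b = b' := h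
  change (of θ ⊚ of ψ).wr g = (of θ).wr g ⊚ (of ψ).wr g
  simp only [← of_comp, ← of_whiskerRight, comp_whiskerRight]

@[simp] theorem wl_id (f : A ⟶ B) (g : B ⟶ C) : (of (𝟙 g)).wl f = of (𝟙 (f ≫ g)) := by
  rw [← of_whiskerLeft, whiskerLeft_id]

@[simp] theorem wr_id (f : A ⟶ B) (g : B ⟶ C) : (of (𝟙 f)).wr g = of (𝟙 (f ≫ g)) := by
  rw [← of_whiskerRight, id_whiskerRight]

/-- The image under a strict 2-functor. -/
def map (T : StrictPseudofunctor K K) (c : TwoCell A B) : TwoCell (T.obj A) (T.obj B) :=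
  of (T.map₂ c.cell)

variable (T : StrictPseudofunctor K K)

@[simp] theorem map_src (c : TwoCell A B) : (c.map T).src = T.map c.src := rfl
@[simp] theorem map_tgt (c : TwoCell A B) : (c.map T).tgt = T.map c.tgt := rfl
@[simp] theorem of_map₂ {f g : A ⟶ B} (θ : f ⟶ g) : of (T.map₂ θ) = (of θ).map T := rfl

@[simp] theorem map_id (f : A ⟶ B) : (of (𝟙 f)).map T = of (𝟙 (T.map f)) := by
  rw [← of_map₂, T.map₂_id]

theorem map_vcomp {c d : TwoCell A B} (h : c.tgt = d.src) : (c ⊚ d).map T = c.map T ⊚ d.map T := by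
  obtain ⟨a, b, θ⟩ := c
  obtain ⟨b', c, ψ⟩ := d
  obtain rfl : b = b' := h
  change (of θ ⊚ of ψ).map T = (of θ).map T ⊚ (of ψ).map T
  simp only [← of_comp, ← of_map₂, T.map₂_comp]

variable [Strict K]

@[simp] theorem wl_wl (f : A ⟶ B) (g : B ⟶ C) (c : TwoCell C D) :
    (c.wl g).wl f = c.wl (f ≫ g) := by
  conv_rhs => rw [wl, comp_whiskerLeft_eqToHom, of_eqToHom_comp, of_comp_eqToHom]
  rfl

@[simp] theorem wr_wr (c : TwoCell A B) (g : B ⟶ C) (h : C ⟶ D) :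
    (c.wr g).wr h = c.wr (g ≫ h) := by
  conv_rhs => rw [wr, whiskerRight_comp_eqToHom, of_eqToHom_comp, of_comp_eqToHom]
  rfl

theorem wl_wr (f : A ⟶ B) (c : TwoCell B C) (h : C ⟶ D) : (c.wl f).wr h = (c.wr h).wl f := by
  conv_lhs => rw [wl, ← of_whiskerRight, whisker_assoc_eqToHom, of_eqToHom_comp,
    of_comp_eqToHom]
  rfl

@[simp] theorem id_wl (c : TwoCell A B) : c.wl (𝟙 A) = c := by
  rw [wl, id_whiskerLeft_eqToHom, of_eqToHom_comp, of_comp_eqToHom]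
  rfl

@[simp] theorem wr_id_one (c : TwoCell A B) : c.wr (𝟙 B) = c := by
  rw [wr, whiskerRight_id_eqToHom, of_eqToHom_comp, of_comp_eqToHom]
  rfl

@[simp] theorem map_wl (f : A ⟶ B) (c : TwoCell B C) : (c.wl f).map T = (c.map T).wl (T.map f) := by
  change of (T.map₂ (f ◁ c.cell)) = _
  rw [_root_.StrictPseudofunctor.map₂_whiskerLeft', of_eqToHom_comp,
    of_comp_eqToHom]
  rfl

@[simp] theorem map_wr (c : TwoCell A B) (g : B ⟶ C) : (c.wr g).map T = (c.map T).wr (T.map g) := by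
  change of (T.map₂ (c.cell ▷ g)) = _
  rw [_root_.StrictPseudofunctor.map₂_whiskerRight', of_eqToHom_comp,
    of_comp_eqToHom]
  rfl

end TwoCell

end BundledCells

/-! ### Discrete opfibrations, 2-pullbacks and classifiers in terms of bundled 2-cells -/

section Limits

variable {K : Type u} [Bicategory.{w, v} K] [Strict K]

open TwoCell

theorem IsDiscreteOpfibration.exists_lift {E B X : K} {p : E ⟶ B} (hp : IsDiscreteOpfibration p)
    (e : X ⟶ E) (c : TwoCell X B) (h : c.src = e ≫ p) :
    ∃ l : TwoCell X E, l.src = e ∧ l.wr p = c := by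
  obtain ⟨a, b, φ⟩ := c
  obtain rfl : a = e ≫ p := h
  obtain ⟨⟨e', l⟩, ⟨he, hl⟩, -⟩ := hp e b φ
  exact ⟨of l, rfl, (of_eq_iff_heq rfl he).2 hl⟩

theorem IsDiscreteOpfibration.cell_ext {E B X : K} {p : E ⟶ B} (hp : IsDiscreteOpfibration p)
    {l l' : TwoCell X E} (h : l.src = l'.src) (h' : l.wr p = l'.wr p) : l = l' := by
  obtain ⟨e, a, l⟩ := l
  obtain ⟨e', a', l'⟩ := l'
  obtain rfl : e = e' := h
  have := (hp e _ (l ▷ p)).unique (y₁ := ⟨a, l⟩) (y₂ := ⟨a', l'⟩) ⟨rfl, HEq.rfl⟩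
    ⟨(congrArg tgt h').symm, (heq_of_of_eq h').symm⟩
  cases this
  rfl

theorem isDiscreteOpfibration_of_cells {E B : K} {p : E ⟶ B}
    (h : ∀ {X : K} (e : X ⟶ E) (c : TwoCell X B), c.src = e ≫ p →
      ∃ l : TwoCell X E, l.src = e ∧ l.wr p = c)
    (h' : ∀ {X : K} (l l' : TwoCell X E), l.src = l'.src → l.wr p = l'.wr p → l = l') :
    IsDiscreteOpfibration p := by
  intro X e b φ
  obtain ⟨⟨_, e', l⟩, rfl, hl⟩ := h e (of φ) rfl
  refine ⟨⟨e', l⟩, ⟨congrArg tgt hl, heq_of_of_eq hl⟩, ?_⟩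
  rintro ⟨e'', l''⟩ ⟨he, hl'⟩
  have := h' (of l'') (of l) rfl (((of_eq_iff_heq rfl he).2 hl').trans hl.symm)
  cases this
  rfl

/-! ### Strict 2-pullbacks: pasting, and stability of discrete opfibrations and small maps. -/

section Pullback

variable {P A D C : K} {p : P ⟶ A} {q : P ⟶ D} {f : A ⟶ C} {g : D ⟶ C}

theorem IsTwoPullback.exists_hom (h : IsTwoPullback p q f g) {Z : K} (x : Z ⟶ A) (y : Z ⟶ D)
    (hxy : x ≫ f = y ≫ g) : ∃ k : Z ⟶ P, k ≫ p = x ∧ k ≫ q = y :=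
  (h.lift x y hxy).exists

theorem IsTwoPullback.hom_ext (h : IsTwoPullback p q f g) {Z : K} {k l : Z ⟶ P}
    (hp : k ≫ p = l ≫ p) (hq : k ≫ q = l ≫ q) : k = l :=
  (h.lift (l ≫ p) (l ≫ q) (by rw [Strict.assoc, h.comm, Strict.assoc])).unique ⟨hp, hq⟩ ⟨rfl, rfl⟩

theorem IsTwoPullback.exists_cell (h : IsTwoPullback p q f g) {Z : K} (c : TwoCell Z A)
    (d : TwoCell Z D) (hcd : c.wr f = d.wr g) :
    ∃ χ : TwoCell Z P, χ.wr p = c ∧ χ.wr q = d := by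
  obtain ⟨a, b, c⟩ := c
  obtain ⟨a', b', d⟩ := d
  obtain ⟨k, rfl, rfl⟩ := h.exists_hom a a' (congrArg src hcd)
  obtain ⟨l, rfl, rfl⟩ := h.exists_hom b b' (congrArg tgt hcd)
  obtain ⟨χ, ⟨rfl, rfl⟩, -⟩ := h.lift₂ k l c d (heq_of_of_eq hcd)
  exact ⟨of χ, rfl, rfl⟩

theorem IsTwoPullback.cell_ext (h : IsTwoPullback p q f g) {Z : K} {χ χ' : TwoCell Z P}
    (hp : χ.wr p = χ'.wr p) (hq : χ.wr q = χ'.wr q) : χ = χ' := by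
  obtain ⟨a, b, c⟩ := χ
  obtain ⟨a', b', d⟩ := χ'
  obtain rfl : a = a' := h.hom_ext (congrArg src hp) (congrArg src hq)
  obtain rfl : b = b' := h.hom_ext (congrArg tgt hp) (congrArg tgt hq)
  have := (h.lift₂ a b (c ▷ p) (c ▷ q) (heq_of_of_eq (by
    simp only [of_whiskerRight, wr_wr, h.comm]))).unique (y₁ := c) (y₂ := d) ⟨rfl, rfl⟩
    ⟨(of_inj.1 hp).symm, (of_inj.1 hq).symm⟩
  rw [this]

theorem isTwoPullback_of_cells (comm : p ≫ f = q ≫ g)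
    (h : ∀ {Z : K} (c : TwoCell Z A) (d : TwoCell Z D), c.wr f = d.wr g →
      ∃ χ : TwoCell Z P, χ.wr p = c ∧ χ.wr q = d)
    (h' : ∀ {Z : K} (χ χ' : TwoCell Z P), χ.wr p = χ'.wr p → χ.wr q = χ'.wr q → χ = χ') :
    IsTwoPullback p q f g := by
  -- A 1-cell is treated as its identity 2-cell, so the property for 2-cells contains the one for
  -- 1-cells.
  have ext {Z : K} (k l : Z ⟶ P) (hp : k ≫ p = l ≫ p) (hq : k ≫ q = l ≫ q) : k = l :=
    congrArg src (h' (of (𝟙 k)) (of (𝟙 l)) (by rw [wr_id, wr_id, hp]) (by rw [wr_id, wr_id, hq]))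
  refine ⟨comm, fun {Z} x y hxy => ?_, fun {Z} k l θ ψ hθψ => ?_⟩
  · obtain ⟨χ, hp, hq⟩ := h (of (𝟙 x)) (of (𝟙 y)) (by rw [wr_id, wr_id, hxy])
    have hp' : χ.src ≫ p = x := congrArg src hp
    have hq' : χ.src ≫ q = y := congrArg src hq
    exact ⟨χ.src, ⟨hp', hq'⟩, fun k hk => ext _ _ (hk.1.trans hp'.symm) (hk.2.trans hq'.symm)⟩
  · have hw (m : Z ⟶ P) : (m ≫ p) ≫ f = (m ≫ q) ≫ g := by rw [Strict.assoc, comm, Strict.assoc]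
    obtain ⟨⟨a, b, χ⟩, hp, hq⟩ := h (of θ) (of ψ) ((of_eq_iff_heq (hw k) (hw l)).2 hθψ)
    obtain rfl : a = k := ext _ _ (congrArg src hp) (congrArg src hq)
    obtain rfl : b = l := ext _ _ (congrArg tgt hp) (congrArg tgt hq)
    refine ⟨χ, ⟨of_inj.1 hp, of_inj.1 hq⟩, fun χ' hχ' => of_inj.1 (h' _ _ ?_ ?_)⟩
    · exact (of_inj.2 hχ'.1).trans hp.symm
    · exact (of_inj.2 hχ'.2).trans hq.symm

theorem IsTwoPullback.flip (h : IsTwoPullback p q f g) : IsTwoPullback q p g f :=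
  isTwoPullback_of_cells h.comm.symm
    (fun c d hcd => (h.exists_cell d c hcd.symm).imp fun _ hχ => hχ.symm)
    fun _ _ hq hp => h.cell_ext hp hq

/-- Pasting of 2-pullbacks. -/
theorem IsTwoPullback.paste (h : IsTwoPullback p q f g) {E F : K} {r : D ⟶ E} {a : C ⟶ F}
    {k : E ⟶ F} (h' : IsTwoPullback g r a k) : IsTwoPullback p (q ≫ r) (f ≫ a) k := by
  refine isTwoPullback_of_cells ?_ (fun c d hcd => ?_) (fun χ χ' hp hq => ?_)
  · rw [← Strict.assoc, h.comm, Strict.assoc, h'.comm, Strict.assoc]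
  · obtain ⟨d', hd, hd'⟩ := h'.exists_cell (c.wr f) d (by rw [wr_wr, hcd])
    obtain ⟨χ, hχ, hχ'⟩ := h.exists_cell c d' hd.symm
    exact ⟨χ, hχ, by rw [← wr_wr, hχ', hd']⟩
  · refine h.cell_ext hp (h'.cell_ext ?_ ?_)
    · rw [wr_wr, wr_wr, ← h.comm, ← wr_wr, hp, wr_wr]
    · rw [wr_wr, wr_wr, hq]

theorem IsTwoPullback.isDiscreteOpfibration (h : IsTwoPullback p q f g)
    (hg : IsDiscreteOpfibration g) : IsDiscreteOpfibration p := by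
  refine isDiscreteOpfibration_of_cells (fun e c hc => ?_) (fun l l' hs hl => ?_)
  · obtain ⟨d, hd, hd'⟩ := hg.exists_lift (e ≫ q) (c.wr f)
      (by rw [wr_src, hc, Strict.assoc, h.comm, Strict.assoc])
    obtain ⟨l, rfl, rfl⟩ := h.exists_cell c d hd'.symm
    exact ⟨l, h.hom_ext hc hd, rfl⟩
  · refine h.cell_ext hl (hg.cell_ext ?_ ?_)
    · rw [wr_src, wr_src, hs]
    · rw [wr_wr, wr_wr, ← h.comm, ← wr_wr, hl, wr_wr]

/-- When the left leg is an identity, the fibre of `k` over `z` is a single point, so `z` has only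
one lift. -/
theorem IsTwoPullback.eq_section {Z Y : K} {x y : Z ⟶ D} {z : Z ⟶ Y} {k : D ⟶ Y}
    (h : IsTwoPullback (𝟙 Z) x z k) (hy : y ≫ k = z) : y = x := by
  obtain ⟨l, hl, rfl⟩ := h.exists_hom (𝟙 Z) y (by rw [hy, Strict.id_comp])
  rw [Strict.comp_id] at hl
  rw [hl, Strict.id_comp]

theorem isTwoPullback_id {A B : K} (f : A ⟶ B) : IsTwoPullback (𝟙 A) f f (𝟙 B) :=
  isTwoPullback_of_cells (by rw [Strict.id_comp, Strict.comp_id])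
    (fun c d h => ⟨c, by simp, by simpa using h⟩) fun _ _ hp _ => by simpa using hp

variable [Enhanced K]

theorem IsLeftTightPullback.paste (h : IsLeftTightPullback p q f g) {E F : K} {r : D ⟶ E}
    {a : C ⟶ F} {k : E ⟶ F} (h' : IsTwoPullback g r a k) :
    IsLeftTightPullback p (q ≫ r) (f ≫ a) k :=
  ⟨h.toIsTwoPullback.paste h', h.tight_left, h.detects⟩

theorem isLeftTightPullback_id {A B : K} (f : A ⟶ B) : IsLeftTightPullback (𝟙 A) f f (𝟙 B) :=
  ⟨isTwoPullback_id f, Enhanced.tight_id A, fun h hh => by rwa [Strict.comp_id] at hh⟩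

/-- The plumbus supplies a left-tight pullback of the same cospan. The two are isomorphic over the
base, and repleteness transfers smallness. This is needed because `T` is only assumed to yield plain
2-pullbacks. -/
theorem PullbackIdeal.small_of_isTwoPullback (hK : IsPlumbus K) (S : PullbackIdeal K)
    (hg : S.small g) (h : IsTwoPullback p q f g) (hp : Enhanced.tight p) : S.small p := by
  obtain ⟨P', p', q', h'⟩ := hK.exists_pullback g f (S.isTightDiscreteOpfibration g hg)
  obtain ⟨k, hk, hk'⟩ := h.exists_hom p' q' h'.comm
  obtain ⟨l, hl, hl'⟩ := h'.exists_hom p q h.comm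
  refine S.replete p' p k l ?_ ?_ hk (S.pullback _ _ _ _ h' hg)
    ⟨hp, h.isDiscreteOpfibration (S.isTightDiscreteOpfibration g hg).2⟩
  · apply h'.hom_ext
    · rw [Strict.assoc, hl, hk, Strict.id_comp]
    · rw [Strict.assoc, hl', hk', Strict.id_comp]
  · apply h.hom_ext
    · rw [Strict.assoc, hk, hl, Strict.id_comp]
    · rw [Strict.assoc, hk', hl', Strict.id_comp]

end Pullback

/-! ### The universal property of a 2-classifier. -/

section Classifier

variable [Enhanced K] {S : PullbackIdeal K} {Ωp Ω : K} {u : Ωp ⟶ Ω}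

namespace PullbackIdeal.IsTwoClassifier

theorem isDiscreteOpfibration (hu : S.IsTwoClassifier u) : IsDiscreteOpfibration u :=
  (S.isTightDiscreteOpfibration u hu.small).2

/-- A small map is the left leg of a classifying square, and such legs detect tightness. -/
theorem detects (hu : S.IsTwoClassifier u) {E B Z : K} {p : E ⟶ B} (hp : S.small p) (h : Z ⟶ E)
    (hh : Enhanced.tight (h ≫ p)) : Enhanced.tight h := by
  obtain ⟨f, e, hf⟩ := hu.classify p hp
  exact hf.detects h hh

theorem isLeftTightPullback (hu : S.IsTwoClassifier u) {P A D C : K} {p : P ⟶ A} {q : P ⟶ D}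
    {f : A ⟶ C} {g : D ⟶ C} (hp : S.small p) (h : IsTwoPullback p q f g) :
    IsLeftTightPullback p q f g :=
  ⟨h, (S.isTightDiscreteOpfibration p hp).1, fun k hk => hu.detects hp k hk⟩

variable {B E : K} {p : E ⟶ B} {e : E ⟶ Ωp} {x : B ⟶ Ω}

/-- A 2-cell out of the classifying map of `p` amounts to a map of cocones under `p`. -/
theorem exists_cell (hK : IsPlumbus K) (hu : S.IsTwoClassifier u)
    (h : IsLeftTightPullback p e x u) (e' : E ⟶ Ωp) (y : B ⟶ Ω) (he' : p ≫ y = e' ≫ u) :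
    ∃ (φ : TwoCell B Ω) (l : TwoCell E Ωp), φ.src = x ∧ φ.tgt = y ∧ l.src = e ∧ l.tgt = e' ∧
      l.wr u = φ.wl p := by
  -- The square over `y` factors through the pullback of `u` along `y`, giving the `k` to which full
  -- faithfulness applies.
  obtain ⟨P, p', q', h'⟩ := hK.exists_pullback u y (S.isTightDiscreteOpfibration u hu.small)
  obtain ⟨k, hk, rfl⟩ := h'.exists_hom p e' he'
  obtain ⟨φ, ⟨-, l, hl⟩, -⟩ := hu.fullyFaithful x y p e p' q' h h' k hk
  refine ⟨of φ, of l, rfl, rfl, rfl, rfl, (of_eq_iff_heq h.comm.symm ?_).2 hl⟩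
  exact he'.symm

theorem cell_ext (hK : IsPlumbus K) (hu : S.IsTwoClassifier u)
    (h : IsLeftTightPullback p e x u) {φ φ' : TwoCell B Ω} {l l' : TwoCell E Ωp}
    (hφ : φ.src = x) (hφ' : φ'.src = x) (ht : φ.tgt = φ'.tgt) (hl : l.src = e) (hl' : l'.src = e)
    (ht' : l.tgt = l'.tgt) (hw : l.wr u = φ.wl p) (hw' : l'.wr u = φ'.wl p) :
    φ = φ' ∧ l = l' := by
  suffices φ = φ' from ⟨this, IsDiscreteOpfibration.cell_ext hu.isDiscreteOpfibration (hl.trans hl'.symm)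
    (by rw [hw, hw', this])⟩
  obtain ⟨x₁, y, φ⟩ := φ
  obtain ⟨x₂, y₂, φ'⟩ := φ'
  obtain ⟨e₁, e', l⟩ := l
  obtain ⟨e₂, e₃, l'⟩ := l'
  dsimp only at hφ hφ' ht hl hl' ht'
  subst hφ hφ' ht hl hl' ht'
  obtain ⟨P, p', q', h'⟩ := hK.exists_pullback u y (S.isTightDiscreteOpfibration u hu.small)
  obtain ⟨k, hk, rfl⟩ := h'.exists_hom p e' (congrArg tgt hw).symm
  exact of_inj.2 ((hu.fullyFaithful _ y p _ p' q' h h' k hk).unique ⟨hk, l, heq_of_of_eq hw⟩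
    ⟨hk, l', heq_of_of_eq hw'⟩)

/-- The domain of a 2-classifier is freely generated by a point under opfibrational lifting. -/
theorem exists_point (hK : IsPlumbus K) (hu : S.IsTwoClassifier u) :
    ∃ (t : K) (π : Ωp ⟶ t) (s : t ⟶ Ωp) (c : TwoCell Ωp Ωp), c.src = π ≫ s ∧ c.tgt = 𝟙 Ωp ∧
      IsLeftTightPullback (𝟙 t) s (s ≫ u) u := by
  obtain ⟨t, ht⟩ := hK.exists_terminal
  obtain ⟨f, s, hs⟩ := hu.classify (𝟙 t) (S.id_terminal t ht)
  obtain ⟨π, -⟩ := ht.exists_tight Ωp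
  obtain rfl : f = s ≫ u := by rw [← hs.comm, Strict.id_comp]
  -- The constant map `π ≫ s ≫ u` classifies the identity of `Ωp`, with top side `π ≫ s`. The square
  -- formed by `𝟙 Ωp` and `u` then yields the 2-cell from `π ≫ s` to `𝟙 Ωp`.
  obtain ⟨φ, l, -, -, hl, hl', -⟩ := exists_cell hK hu
    ((isLeftTightPullback_id π).paste hs.toIsTwoPullback) (𝟙 Ωp) u rfl
  exact ⟨t, π, s, l, hl, hl', hs⟩

end PullbackIdeal.IsTwoClassifier

end Classifier

end Limits

/-! ### Algebras and lax morphisms in terms of bundled 2-cells -/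

section AlgebraCells

variable {K : Type u} [Bicategory.{w, v} K] [Strict K]

open TwoCell

/-- Whiskering `d` with `a` and with `a'` gives two lifts of one 2-cell with the same source, hence
with the same target. For `d` as in `exists_point`, two maps over the same base agree once they
agree at the point. -/
theorem IsDiscreteOpfibration.tgt_comp_eq {E B Y Z : K} {p : E ⟶ B} (hp : IsDiscreteOpfibration p)
    (d : TwoCell Z Y) {a a' : Y ⟶ E} (h : a ≫ p = a' ≫ p) (hs : d.src ≫ a = d.src ≫ a') :
    d.tgt ≫ a = d.tgt ≫ a' :=
  congrArg tgt (hp.cell_ext (l := d.wr a) (l' := d.wr a') hs (by rw [wr_wr, wr_wr, h]))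

/-! ### One-dimensional universal property of the comma object. -/

section Comma

variable {X B : K} {b : X ⟶ B} (C : RepComma b)

theorem RepComma.exists_hom {Z : K} (x : Z ⟶ X) (c : TwoCell Z B) (hc : c.src = x ≫ b) :
    ∃ h : Z ⟶ C.pt, h ≫ C.dom = x ∧ (of C.cell).wl h = c := by
  obtain ⟨a, y, c⟩ := c
  obtain rfl : a = x ≫ b := hc
  obtain ⟨h, ⟨rfl, hy, hc⟩, -⟩ := C.lift x y c
  exact ⟨h, rfl, (of_eq_iff_heq (Strict.assoc _ _ _).symm hy).2 hc⟩

theorem RepComma.hom_ext {Z : K} {h k : Z ⟶ C.pt} (hd : h ≫ C.dom = k ≫ C.dom)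
    (hc : (of C.cell).wl h = (of C.cell).wl k) : h = k := by
  have hc' : h ≫ C.cod = k ≫ C.cod := congrArg tgt hc
  refine (C.lift (k ≫ C.dom) (k ≫ C.cod) ((α_ k C.dom b).hom ≫ k ◁ C.cell)).unique
    ⟨hd, hc', heq_of_of_eq ?_⟩ ⟨rfl, rfl, heq_of_of_eq ?_⟩ <;>
  rw [Strict.associator_eqToIso, eqToIso.hom, of_eqToHom_comp]
  exact hc

end Comma

variable [Enhanced K]

namespace EnhancedTwoMonad

variable {T : EnhancedTwoMonad K}

theorem i_comp_map_comp (T : EnhancedTwoMonad K) {A B C : K} (f : A ⟶ B) (g : T.obj B ⟶ C) :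
    T.i A ≫ T.map f ≫ g = f ≫ T.i B ≫ g := by
  rw [← Strict.assoc, T.i_naturality, Strict.assoc]

theorem m_comp_map_comp (T : EnhancedTwoMonad K) {A B C : K} (f : A ⟶ B) (g : T.obj B ⟶ C) :
    T.m A ≫ T.map f ≫ g = T.map (T.map f) ≫ T.m B ≫ g := by
  rw [← Strict.assoc, T.m_naturality, Strict.assoc]

theorem wl_i_map (T : EnhancedTwoMonad K) {A B : K} (c : TwoCell A B) :
    (c.map T.toStrictPseudofunctor).wl (T.i A) = c.wr (T.i B) :=
  (of_eq_iff_heq (T.i_naturality _) (T.i_naturality _)).2 (T.i_naturality₂ c.cell)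

theorem wl_m_map (T : EnhancedTwoMonad K) {A B : K} (c : TwoCell A B) :
    (c.map T.toStrictPseudofunctor).wl (T.m A) =
      ((c.map T.toStrictPseudofunctor).map T.toStrictPseudofunctor).wr (T.m B) :=
  (of_eq_iff_heq (T.m_naturality _) (T.m_naturality _)).2 (T.m_naturality₂ c.cell)

theorem IsAlgebra.unit_comp {A Z : K} {a : T.obj A ⟶ A} (ha : T.IsAlgebra a) (f : A ⟶ Z) :
    T.i A ≫ a ≫ f = f := by
  rw [← Strict.assoc, ha.unit, Strict.id_comp]

theorem IsAlgebra.assoc_comp {A Z : K} {a : T.obj A ⟶ A} (ha : T.IsAlgebra a) (f : A ⟶ Z) :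
    T.m A ≫ a ≫ f = T.map a ≫ a ≫ f := by
  rw [← Strict.assoc, ha.assoc, Strict.assoc]

/-! ### Axioms of lax and colax morphisms, and the forgetful passage on 2-cells. -/

section Hom

variable {A B : AlgLx T}

theorem LaxHom.wl_i_lax (f : LaxHom A B) : (of f.lax).wl (T.i A.carrier) = of (𝟙 f.map) := by
  refine (of_eq_iff_heq ?_ ?_).2 f.lax_unit
  · simp only [of_src, i_comp_map_comp, B.isAlgebra.unit, Strict.comp_id]
  · simp only [of_tgt, A.isAlgebra.unit_comp]

theorem LaxHom.wl_m_lax (f : LaxHom A B) : (of f.lax).wl (T.m A.carrier) =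
    ((of f.lax).map T.toStrictPseudofunctor).wr B.str ⊚ (of f.lax).wl (T.map A.str) := by
  rw [← of_map₂, ← of_whiskerRight, ← of_whiskerLeft, ← of_whiskerLeft]
  refine Eq.trans ((of_eq_iff_heq ?_ ?_).2 f.lax_mult) ?_
  · rw [m_comp_map_comp, B.isAlgebra.assoc, T.map_comp, Strict.assoc]
  · rw [A.isAlgebra.assoc_comp]
  · rw [of_comp, of_eqToHom_comp]

theorem LaxHom.exists_of_cell (f : A.carrier ⟶ B.carrier) (c : TwoCell (T.obj A.carrier) B.carrier)
    (hs : c.src = T.map f ≫ B.str) (ht : c.tgt = A.str ≫ f)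
    (hi : c.wl (T.i A.carrier) = of (𝟙 f))
    (hm : c.wl (T.m A.carrier) =
      (c.map T.toStrictPseudofunctor).wr B.str ⊚ c.wl (T.map A.str)) :
    ∃ F : LaxHom A B, F.map = f ∧ of F.lax = c := by
  obtain ⟨a, a', c⟩ := c
  dsimp only at hs ht
  subst hs ht
  change (of c).wl _ = ((of c).map _).wr B.str ⊚ (of c).wl _ at hm
  refine ⟨⟨f, c, heq_of_of_eq hi, heq_of_of_eq ?_⟩, rfl, rfl⟩
  rw [of_comp, of_eqToHom_comp]
  exact hm

theorem LaxHom.ext_of {f g : LaxHom A B} (h : f.map = g.map) (h' : of f.lax = of g.lax) : f = g :=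
  LaxHom.ext h (heq_of_of_eq h')

theorem ColaxHom.wl_i_colax (f : ColaxHom A B) :
    (of f.colax).wl (T.i A.carrier) = of (𝟙 f.map) := by
  refine (of_eq_iff_heq ?_ ?_).2 f.colax_unit
  · simp only [of_src, A.isAlgebra.unit_comp]
  · simp only [of_tgt, i_comp_map_comp, B.isAlgebra.unit, Strict.comp_id]

theorem ColaxHom.wl_m_colax (f : ColaxHom A B) : (of f.colax).wl (T.m A.carrier) =
    (of f.colax).wl (T.map A.str) ⊚ ((of f.colax).map T.toStrictPseudofunctor).wr B.str := by
  rw [← of_map₂, ← of_whiskerRight, ← of_whiskerLeft, ← of_whiskerLeft]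
  refine Eq.trans ((of_eq_iff_heq ?_ ?_).2 f.colax_mult) ?_
  · rw [A.isAlgebra.assoc_comp]
  · rw [m_comp_map_comp, B.isAlgebra.assoc, T.map_comp, Strict.assoc]
  · rw [of_comp, of_eqToHom_comp]

theorem LaxHom.of_lax_comp {D : AlgLx T} (f : LaxHom A B) (g : LaxHom B D) :
    of (LaxHom.lax (f.comp g)) = (of g.lax).wl (T.map f.map) ⊚ (of f.lax).wr g.map := by
  refine (of_eqToHom_comp _ _).trans ((of_comp _ _).trans (congrArg _ ?_))
  exact (of_eqToHom_comp _ _).trans (of_comp_eqToHom _ _)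

theorem LaxHom.of_lax_ofStrict (f : A.carrier ⟶ B.carrier) (hf : T.map f ≫ B.str = A.str ≫ f) :
    of (LaxHom.ofStrict (A := A) (B := B) f hf).lax = of (𝟙 (A.str ≫ f)) := by
  refine (of_eqToHom hf).trans ?_
  rw [hf]

/-- The underlying 2-cell of a `T`-2-morphism. -/
def forget (c : TwoCell A B) : TwoCell A.carrier B.carrier := of (LaxHom.Cell.cell c.cell)

theorem forget_comm (c : TwoCell A B) :
    ((forget c).map T.toStrictPseudofunctor).wr B.str ⊚ of (LaxHom.lax c.tgt) =
      of (LaxHom.lax c.src) ⊚ (forget c).wl A.str := by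
  have := congrArg of (LaxHom.Cell.comm c.cell)
  rwa [of_comp, of_comp] at this

theorem forget_ext {c c' : TwoCell A B} (hs : c.src = c'.src) (ht : c.tgt = c'.tgt)
    (h : forget c = forget c') : c = c' := by
  obtain ⟨a, b, c⟩ := c
  obtain ⟨a', b', c'⟩ := c'
  dsimp only at hs ht
  subst hs ht
  have : c = c' := LaxHom.hom_ext (of_inj.1 h)
  rw [this]

theorem exists_forget_eq (f g : A ⟶ B) (c : TwoCell A.carrier B.carrier)
    (hs : c.src = LaxHom.map f) (ht : c.tgt = LaxHom.map g)
    (h : (c.map T.toStrictPseudofunctor).wr B.str ⊚ of (LaxHom.lax g) =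
      of (LaxHom.lax f) ⊚ c.wl A.str) :
    ∃ d : TwoCell A B, d.src = f ∧ d.tgt = g ∧ forget d = c := by
  obtain ⟨a, b, c⟩ := c
  dsimp only at hs ht
  subst hs ht
  refine ⟨⟨f, g, ⟨c, of_inj.1 ?_⟩⟩, rfl, rfl, rfl⟩
  rw [of_comp, of_comp]
  exact h

theorem forget_wr {D : AlgLx T} (c : TwoCell A B) (g : B ⟶ D) :
    forget (c.wr g) = (forget c).wr (LaxHom.map g) := rfl

end Hom

theorem LaxHom.of_lax_comp_ofStrict {A E B : AlgLx T} {p : E.carrier ⟶ B.carrier}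
    (hps : T.map p ≫ B.str = E.str ≫ p) (h : LaxHom A E) :
    of (LaxHom.lax (h.comp (LaxHom.ofStrict p hps))) = (of h.lax).wr p := by
  rw [LaxHom.of_lax_comp, LaxHom.of_lax_ofStrict, wl_id]
  refine id_vcomp ?_
  change (T.map h.map ≫ E.str) ≫ p = _
  rw [Strict.assoc]

/-- A lax structure on `h` can be checked after composing with a strict morphism that is a discrete
opfibration. -/
theorem LaxHom.exists_of_comp {A E B : AlgLx T} {p : E.carrier ⟶ B.carrier}
    (hp : IsDiscreteOpfibration p) (hps : T.map p ≫ B.str = E.str ≫ p) (x : LaxHom A B)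
    (h : A.carrier ⟶ E.carrier) (hx : h ≫ p = x.map) (c : TwoCell (T.obj A.carrier) E.carrier)
    (hs : c.src = T.map h ≫ E.str) (ht : c.tgt = A.str ≫ h) (hc : c.wr p = of x.lax) :
    ∃ H : LaxHom A E, H.map = h ∧ of H.lax = c := by
  refine LaxHom.exists_of_cell h c hs ht (hp.cell_ext ?_ ?_) (hp.cell_ext ?_ ?_)
  · rw [wl_src, hs, i_comp_map_comp, E.isAlgebra.unit, Strict.comp_id, of_src]
  · rw [wl_wr, hc, x.wl_i_lax, wr_id, hx]
  · rw [wl_src, vcomp_src, wr_src, map_src, hs, m_comp_map_comp, E.isAlgebra.assoc, T.map_comp,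
      Strict.assoc]
  · rw [wl_wr, hc, x.wl_m_lax, wr_vcomp, wr_wr, ← hps, wl_wr, hc, ← hc, map_wr, wr_wr]
    rw [wr_tgt, map_tgt, wl_src, hs, ht, T.map_comp, Strict.assoc]

/-- Strict morphisms that are discrete opfibrations lift to discrete opfibrations of algebras. -/
theorem isDiscreteOpfibration_ofStrict {E B : AlgLx T} {p : E.carrier ⟶ B.carrier}
    (hp : IsDiscreteOpfibration p) (hps : T.map p ≫ B.str = E.str ≫ p) :
    IsDiscreteOpfibration (K := AlgLx T) (E := E) (B := B) (LaxHom.ofStrict p hps) := by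
  refine isDiscreteOpfibration_of_cells (K := AlgLx T) ?_ ?_
  · intro A e c hc
    have hsrc : (forget c).src = LaxHom.map e ≫ p := congrArg LaxHom.map hc
    have hsrc' : of (LaxHom.lax c.src) = (of (LaxHom.lax e)).wr p :=
      (congrArg (fun x => of (LaxHom.lax x)) hc).trans (LaxHom.of_lax_comp_ofStrict hps e)
    have hcomm := forget_comm c
    obtain ⟨l, hl, hl'⟩ := hp.exists_lift _ _ hsrc
    have htgt : l.tgt ≫ p = LaxHom.map c.tgt := congrArg tgt hl'
    -- The laxator of the target of `l` can only be the lift of the laxator downstairs. That it ends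
    -- at `A.str ≫ l.tgt` follows from `hlk`, where two lifts of the same 2-cell are compared.
    obtain ⟨k, hk, hk'⟩ := hp.exists_lift (T.map l.tgt ≫ E.str) (of (LaxHom.lax c.tgt)) (by
      rw [of_src, Strict.assoc, ← hps, ← Strict.assoc, ← T.map_comp, htgt])
    have hm : ((l.map T.toStrictPseudofunctor).wr E.str).tgt = k.src := by
      rw [hk]; rfl
    have hm' : (of (LaxHom.lax e)).tgt = (l.wl A.str).src := by
      rw [wl_src, hl]; rfl
    have hlk : (l.map T.toStrictPseudofunctor).wr E.str ⊚ k =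
        of (LaxHom.lax e) ⊚ l.wl A.str := by
      refine hp.cell_ext ?_ ?_
      · rw [vcomp_src, vcomp_src, wr_src, map_src, hl]; rfl
      · rw [wr_vcomp hm, wr_vcomp hm', wr_wr, ← hps, ← wr_wr, ← map_wr, hl', hk', wl_wr, hl',
          ← hsrc', hcomm]
    have hk'' : k.tgt = A.str ≫ l.tgt := by
      have := congrArg tgt hlk
      rwa [vcomp_tgt hm, vcomp_tgt hm'] at this
    obtain ⟨g, hg, hg'⟩ := LaxHom.exists_of_comp hp hps c.tgt l.tgt htgt k hk hk'' hk'
    obtain ⟨d, rfl, rfl, hd⟩ := exists_forget_eq (A := A) (B := E) e g l hl hg.symm (by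
      rw [hg']; exact hlk)
    refine ⟨d, rfl, forget_ext hc.symm ?_ ?_⟩
    · refine LaxHom.ext_of ?_ ((LaxHom.of_lax_comp_ofStrict hps _).trans ?_)
      · change LaxHom.map d.tgt ≫ p = _
        rw [hg, htgt]
      · rw [hg', hk']
    · rw [forget_wr, hd]
      exact hl'
  · intro A l l' hs hl
    have hf : forget l = forget l' := by
      refine hp.cell_ext (congrArg LaxHom.map hs) ?_
      exact congrArg forget hl
    refine forget_ext hs (LaxHom.ext_of (congrArg tgt hf) (hp.cell_ext ?_ ?_)) hf
    · change T.map (forget l).tgt ≫ _ = T.map (forget l').tgt ≫ _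
      rw [hf]
    · rw [← LaxHom.of_lax_comp_ofStrict hps, ← LaxHom.of_lax_comp_ofStrict hps]
      exact congrArg (fun x => of (LaxHom.lax (TwoCell.tgt x))) hl

/-! ### The algebra structure on the comma object. -/

section Comma

variable {X B : AlgLx T} (b : ColaxHom X B) (C : RepComma b.map)

theorem ColaxHom.commaStr_dom : b.commaStr C ≫ C.dom = T.map C.dom ≫ X.str :=
  (b.commaStr_spec C).1

theorem ColaxHom.commaStr_cod : b.commaStr C ≫ C.cod = T.map C.cod ≫ B.str :=
  (b.commaStr_spec C).2.1

theorem ColaxHom.wl_commaStr : (of C.cell).wl (b.commaStr C) =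
    (of b.colax).wl (T.map C.dom) ⊚ ((of C.cell).map T.toStrictPseudofunctor).wr B.str := by
  have h1 : of (b.commaCell C) =
      (of b.colax).wl (T.map C.dom) ⊚ ((of C.cell).map T.toStrictPseudofunctor).wr B.str := by
    rw [commaCell, Strict.associator_eqToIso, eqToIso.hom, of_eqToHom_comp, of_comp,
      of_eqToHom_comp]
    rfl
  refine Eq.trans ((of_eq_iff_heq ?_ ?_).2 (b.commaStr_spec C).2.2) h1
  · rw [of_src, ← Strict.assoc, b.commaStr_dom]
  · exact b.commaStr_cod C

theorem ColaxHom.commaStr_matching : ((of b.colax).wl (T.map C.dom)).tgt =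
    (((of C.cell).map T.toStrictPseudofunctor).wr B.str).src := by
  simp only [wl_tgt, wr_src, map_src, of_src, of_tgt, T.map_comp, Strict.assoc]

/-- Maps into a comma object are determined by their composites with `dom` and `cell`. On `dom` the
laws are those of `X`; on `cell` they are the axioms of the colaxator combined with the laws of `B`
and the 2-naturality of `i` and `m`. -/
theorem ColaxHom.isAlgebra_commaStr (h : Enhanced.tight (b.commaStr C)) :
    T.IsAlgebra (b.commaStr C) := by
  refine ⟨h, C.hom_ext ?_ ?_, C.hom_ext ?_ ?_⟩
  · rw [Strict.assoc, b.commaStr_dom, i_comp_map_comp, X.isAlgebra.unit, Strict.comp_id,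
      Strict.id_comp]
  · rw [← wl_wl, b.wl_commaStr, wl_vcomp _ (b.commaStr_matching C), wl_wl, T.i_naturality,
      ← wl_wl, b.wl_i_colax, ← wl_wr, wl_i_map, wr_wr, B.isAlgebra.unit, wr_id_one, wl_id, id_wl]
    exact id_vcomp rfl
  · simp only [Strict.assoc, b.commaStr_dom, m_comp_map_comp, X.isAlgebra.assoc]
    rw [← Strict.assoc, ← Strict.assoc, ← T.map_comp, ← T.map_comp, b.commaStr_dom]
  · rw [← wl_wl, b.wl_commaStr, wl_vcomp _ (b.commaStr_matching C), wl_wl, T.m_naturality,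
      ← wl_wl, b.wl_m_colax, ← wl_wr, wl_m_map, wr_wr, B.isAlgebra.assoc, ← wl_wl, b.wl_commaStr,
      wl_vcomp _ (b.commaStr_matching C), ← wl_wr, ← map_wl, b.wl_commaStr,
      map_vcomp _ (b.commaStr_matching C), wr_vcomp _ _, wl_vcomp _ _, vcomp_assoc _ _, wl_wl, wl_wl,
      ← T.map_comp, ← T.map_comp, b.commaStr_dom, map_wl, map_wr, wl_wr, wr_wr]
    all_goals
      simp only [map_src, map_tgt, wl_src, wl_tgt, wr_src, wr_tgt, of_src, of_tgt, T.map_comp,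
        Strict.assoc]

end Comma

/-! ### The action of `T` on classifying squares, and the algebra `Ωp`. -/

section Classifier

variable {S : PullbackIdeal K} {Ωp Ω : K} {u : Ωp ⟶ Ω} {ωp : T.obj Ωp ⟶ Ωp} {ω : T.obj Ω ⟶ Ω}

theorem LiftsClassifier.isLeftTightPullback (hK : IsPlumbus K) (hu : S.IsTwoClassifier u)
    (hT : T.LiftsClassifier S u ωp ω) {E B : K} {p : E ⟶ B} {e : E ⟶ Ωp} {f : B ⟶ Ω}
    (h : IsLeftTightPullback p e f u) :
    IsLeftTightPullback (T.map p) (T.map e ≫ ωp) (T.map f ≫ ω) u :=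
  (hu.isLeftTightPullback (S.small_of_isTwoPullback hK hT.small (hT.map_pullback p e f h)
    (T.map_tight p h.tight_left)) (hT.map_pullback p e f h)).paste hT.classifies.toIsTwoPullback

/-- Both sides of each law agree over `u`, since `ω` satisfies the law. By `tgt_comp_eq` it remains
to compare them at the point `s`, where the lift through `u` is unique. -/
theorem LiftsClassifier.isAlgebra_top (hK : IsPlumbus K) (hu : S.IsTwoClassifier u)
    (hT : T.LiftsClassifier S u ωp ω) : T.IsAlgebra ωp := by
  have hcomm := hT.classifies.comm
  have htight := (S.isTightDiscreteOpfibration u hu.small).1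
  have hdisc : IsDiscreteOpfibration u := hu.isDiscreteOpfibration
  obtain ⟨t, π, s, c, hc, hc', hs⟩ := hu.exists_point hK
  refine ⟨hu.detects hu.small ωp ?_, ?_, ?_⟩
  · rw [← hcomm]
    exact Enhanced.tight_comp _ _ (T.map_tight u htight) hT.isAlgebra.tight
  · have h1 : (T.i Ωp ≫ ωp) ≫ u = 𝟙 Ωp ≫ u := by
      rw [Strict.assoc, ← hcomm, i_comp_map_comp, hT.isAlgebra.unit, Strict.comp_id,
        Strict.id_comp]
    have := IsDiscreteOpfibration.tgt_comp_eq hdisc c h1 (by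
      rw [hc, Strict.assoc, Strict.assoc, Strict.comp_id]
      congr 1
      refine hs.eq_section ?_
      rw [Strict.assoc, h1, Strict.id_comp])
    rwa [hc', Strict.id_comp, Strict.id_comp] at this
  · have h1 : (T.m Ωp ≫ ωp) ≫ u = (T.map ωp ≫ ωp) ≫ u := by
      rw [Strict.assoc, ← hcomm, m_comp_map_comp, hT.isAlgebra.assoc, Strict.assoc, ← hcomm,
        ← Strict.assoc, ← T.map_comp, hcomm, T.map_comp, Strict.assoc, hcomm]
    -- For associativity the 2-cell from the point is moved by `T` twice, and so is the pullback
    -- square whose left leg is the identity of `t`.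
    have h2 := hT.isLeftTightPullback hK hu (hT.isLeftTightPullback hK hu hs)
    rw [T.map_id, T.map_id] at h2
    have := IsDiscreteOpfibration.tgt_comp_eq hdisc
      ((c.map T.toStrictPseudofunctor).map T.toStrictPseudofunctor) h1 (by
      rw [map_src, map_src, hc, T.map_comp, T.map_comp, Strict.assoc, Strict.assoc]
      congr 1
      rw [← Strict.assoc _ (T.map ωp), ← T.map_comp]
      refine h2.eq_section ?_
      have h3 := h2.comm
      rw [Strict.id_comp] at h3
      rw [Strict.assoc, h1, h3, T.map_comp, Strict.assoc, Strict.assoc, Strict.assoc])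
    rwa [map_tgt, map_tgt, hc', T.map_id, T.map_id, Strict.id_comp, Strict.id_comp] at this

end Classifier

end EnhancedTwoMonad

end AlgebraCells

/-! ### Classifying maps of algebras -/

section ClassifyingMaps

variable {K : Type u} [Bicategory.{w, v} K] [Strict K]

open TwoCell

theorem IsTwoPullback.of_iso {P P' A D C : K} {p : P ⟶ A} {q : P ⟶ D} {f : A ⟶ C} {g : D ⟶ C}
    (h : IsTwoPullback p q f g) {d : P' ⟶ P} {s : P ⟶ P'} (hds : d ≫ s = 𝟙 P')
    (hsd : s ≫ d = 𝟙 P) : IsTwoPullback (d ≫ p) (d ≫ q) f g := by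
  refine isTwoPullback_of_cells ?_ (fun c c' hc => ?_) (fun χ χ' hp hq => ?_)
  · rw [Strict.assoc, h.comm, Strict.assoc]
  · obtain ⟨χ, rfl, rfl⟩ := h.exists_cell c c' hc
    refine ⟨χ.wr s, ?_, ?_⟩ <;> rw [wr_wr, ← Strict.assoc, hsd, Strict.id_comp]
  · have : χ.wr d = χ'.wr d := h.cell_ext (by rw [wr_wr, wr_wr, hp]) (by rw [wr_wr, wr_wr, hq])
    rw [← wr_id_one χ, ← wr_id_one χ', ← hds, ← wr_wr, this, wr_wr]

theorem IsTwoPullback.of_iso_left {P A A' D C : K} {p : P ⟶ A} {q : P ⟶ D} {f : A' ⟶ C}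
    {g : D ⟶ C} {j : A ⟶ A'} {k : A' ⟶ A} (h : IsTwoPullback p q (j ≫ f) g)
    (hjk : j ≫ k = 𝟙 A) (hkj : k ≫ j = 𝟙 A') : IsTwoPullback (p ≫ j) q f g := by
  refine isTwoPullback_of_cells ?_ (fun c c' hc => ?_) (fun χ χ' hp hq => h.cell_ext ?_ hq)
  · rw [Strict.assoc, h.comm]
  · obtain ⟨χ, hχ, hχ'⟩ := h.exists_cell (c.wr k) c' (by
      rw [wr_wr, ← Strict.assoc, hkj, Strict.id_comp, hc])
    refine ⟨χ, ?_, hχ'⟩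
    rw [← wr_wr, hχ, wr_wr, hkj, wr_id_one]
  · have hp' := congrArg (fun c => c.wr k) hp
    simpa only [wr_wr, Strict.assoc, hjk, Strict.comp_id] using hp'

variable [Enhanced K]

namespace EnhancedTwoMonad

variable {T : EnhancedTwoMonad K}

/-- A `T`-cartesian discrete opfibration is one whose structure square is a 2-pullback. -/
theorem IsCartesian.isTwoPullback {A B : K} {a : T.obj A ⟶ A} {b : T.obj B ⟶ B} {f : A ⟶ B}
    (h : T.IsCartesian a b f) (hf : IsDiscreteOpfibration (T.map f)) :
    IsTwoPullback (T.map f) a b f := by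
  obtain ⟨-, P, p, q, d, hP, rfl, hq, s, hs, ⟨τ⟩⟩ := h
  suffices hds : d ≫ s = 𝟙 _ by
    have := (hP.of_iso hds hs).flip
    rwa [hq] at this
  have hm : ((of τ.inv).wr (d ≫ s)).tgt = (of τ.hom).src := by
    rw [wr_tgt, of_tgt, of_src, Strict.assoc, ← Strict.assoc s, hs, Strict.id_comp]
  -- The isomorphism `τ` need not lie over an identity. Precomposing it with its own inverse
  -- whiskered by `d ≫ s` corrects this, as `s ≫ d` is an identity. A lift of an identity along
  -- `T.map f` is an identity, so source and target coincide.
  have key : (of τ.inv).wr (d ≫ s) ⊚ of τ.hom = of (𝟙 (d ≫ s)) := by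
    refine hf.cell_ext ?_ ?_
    · rw [vcomp_src, wr_src, of_src, of_src, Strict.id_comp]
    · have h1 : (d ≫ s) ≫ d ≫ q = d ≫ q := by
        rw [Strict.assoc, ← Strict.assoc s, hs, Strict.id_comp]
      rw [wr_vcomp hm, ← hq, wr_wr, h1, ← wr_vcomp rfl, ← of_comp, τ.inv_hom_id, wr_id, wr_id, h1,
        Strict.id_comp]
  have := congrArg tgt key
  rw [vcomp_tgt hm] at this
  exact this.symm

/-! ### Independence of the choice of comma object. -/

section Comma

variable {X B : AlgLx T} (b : ColaxHom X B)

/-- Two comma objects of `b` are isomorphic by maps compatible with the structure maps, and the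
split equivalence is transported along them. This reconciles the existential in `IsCartesianAt` with
a given `C`. -/
theorem ColaxHom.isCartesian_of_repComma (C C' : RepComma b.map)
    (h : T.IsCartesian (b.commaStr C') B.str C'.cod) :
    T.IsCartesian (b.commaStr C) B.str C.cod := by
  obtain ⟨j, hj, hj'⟩ := C.exists_hom C'.dom (of C'.cell) rfl
  obtain ⟨k, hk, hk'⟩ := C'.exists_hom C.dom (of C.cell) rfl
  have hcod : j ≫ C.cod = C'.cod := congrArg tgt hj'
  have hjk : j ≫ k = 𝟙 _ := C'.hom_ext (by rw [Strict.assoc, hk, hj, Strict.id_comp])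
    (by rw [← wl_wl, hk', hj', id_wl])
  have hkj : k ≫ j = 𝟙 _ := C.hom_ext (by rw [Strict.assoc, hj, hk, Strict.id_comp])
    (by rw [← wl_wl, hj', hk', id_wl])
  have hstr : b.commaStr C' ≫ j = T.map j ≫ b.commaStr C := by
    refine C.hom_ext ?_ ?_
    · rw [Strict.assoc, hj, b.commaStr_dom, Strict.assoc, b.commaStr_dom, ← Strict.assoc,
        ← T.map_comp, hj]
    · rw [← wl_wl, hj', b.wl_commaStr, ← wl_wl, b.wl_commaStr,
        wl_vcomp _ (b.commaStr_matching C), wl_wl, ← T.map_comp, hj, ← wl_wr, ← map_wl, hj']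
  have hkstr : T.map k ≫ b.commaStr C' ≫ j = b.commaStr C := by
    rw [hstr, ← Strict.assoc, ← T.map_comp, hkj, T.map_id, Strict.id_comp]
  obtain ⟨-, P, p, q, d, hP, hp, hq, s, hs, ⟨τ⟩⟩ := h
  refine ⟨(b.commaStr_cod C).symm, P, p ≫ j, q, T.map k ≫ d, ?_, ?_, ?_, s ≫ T.map j, ?_, ⟨?_⟩⟩
  · rw [← hcod] at hP
    exact hP.of_iso_left hjk hkj
  · rw [Strict.assoc, ← Strict.assoc d, hp, hkstr]
  · rw [Strict.assoc, hq, ← T.map_comp, ← hcod, ← Strict.assoc, hkj, Strict.id_comp]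
  · rw [Strict.assoc, ← Strict.assoc (T.map j), ← T.map_comp, hjk, T.map_id, Strict.id_comp, hs]
  · exact eqToIso (by simp only [Strict.assoc]) ≪≫
      Bicategory.whiskerLeftIso (T.map k) (Bicategory.whiskerRightIso τ (T.map j)) ≪≫
      eqToIso (by rw [Strict.id_comp, ← T.map_comp, hkj, T.map_id])

theorem ColaxHom.isCartesianAt_iff (C : RepComma b.map) :
    b.IsCartesianAt ↔ T.IsCartesian (b.commaStr C) B.str C.cod :=
  ⟨fun ⟨C', h⟩ => b.isCartesian_of_repComma C C' h, fun h => ⟨C, h⟩⟩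

end Comma

/-! ### The laxator of a classifying map. -/

section Classify

variable {S : PullbackIdeal K} {Ωp Ω : K} {u : Ωp ⟶ Ω} {ωp : T.obj Ωp ⟶ Ωp} {ω : T.obj Ω ⟶ Ω}
  {A B : AlgLx T} {p : A.carrier ⟶ B.carrier} {e : A.carrier ⟶ Ωp} {f : B.carrier ⟶ Ω}
  {φ : TwoCell (T.obj B.carrier) Ω} {l : TwoCell (T.obj A.carrier) Ωp}

/-- After restriction along the unit, both pairs are 2-cells out of the pair `f`, `e` classifying
`p`, with equal targets, so `cell_ext` identifies them. -/
theorem LiftsClassifier.wl_i (hK : IsPlumbus K) (hu : S.IsTwoClassifier u)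
    (hT : T.LiftsClassifier S u ωp ω) (h : IsLeftTightPullback p e f u)
    (hφ : φ.src = T.map f ≫ ω) (hφ' : φ.tgt = B.str ≫ f) (hl : l.src = T.map e ≫ ωp)
    (hl' : l.tgt = A.str ≫ e) (hw : l.wr u = φ.wl (T.map p)) :
    φ.wl (T.i B.carrier) = of (𝟙 f) ∧ l.wl (T.i A.carrier) = of (𝟙 e) := by
  refine hu.cell_ext hK h ?_ rfl ?_ ?_ rfl ?_ ?_ ?_
  · rw [wl_src, hφ, i_comp_map_comp, hT.isAlgebra.unit, Strict.comp_id]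
  · rw [wl_tgt, hφ', B.isAlgebra.unit_comp, of_tgt]
  · rw [wl_src, hl, i_comp_map_comp, (hT.isAlgebra_top hK hu).unit, Strict.comp_id]
  · rw [wl_tgt, hl', A.isAlgebra.unit_comp, of_tgt]
  · rw [wl_wr, hw, wl_wl, wl_wl, T.i_naturality]
  · rw [wr_id, wl_id, h.comm]

/-- The same comparison as for the unit, now for pairs out of the classifying map of `T (T p)`. -/
theorem LiftsClassifier.wl_m (hK : IsPlumbus K) (hu : S.IsTwoClassifier u)
    (hT : T.LiftsClassifier S u ωp ω) (hp : T.map p ≫ B.str = A.str ≫ p)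
    (h : IsLeftTightPullback p e f u)
    (hφ : φ.src = T.map f ≫ ω) (hφ' : φ.tgt = B.str ≫ f) (hl : l.src = T.map e ≫ ωp)
    (hl' : l.tgt = A.str ≫ e) (hw : l.wr u = φ.wl (T.map p)) :
    φ.wl (T.m B.carrier) =
      (φ.map T.toStrictPseudofunctor).wr ω ⊚ φ.wl (T.map B.str) ∧
    l.wl (T.m A.carrier) =
      (l.map T.toStrictPseudofunctor).wr ωp ⊚ l.wl (T.map A.str) := by
  have hmφ : ((φ.map T.toStrictPseudofunctor).wr ω).tgt = (φ.wl (T.map B.str)).src := by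
    rw [wr_tgt, map_tgt, wl_src, hφ, hφ', T.map_comp, Strict.assoc]
  have hml : ((l.map T.toStrictPseudofunctor).wr ωp).tgt = (l.wl (T.map A.str)).src := by
    rw [wr_tgt, map_tgt, wl_src, hl, hl', T.map_comp, Strict.assoc]
  refine hu.cell_ext hK (hT.isLeftTightPullback hK hu (hT.isLeftTightPullback hK hu h))
    ?_ ?_ ?_ ?_ ?_ ?_ ?_ ?_
  · rw [wl_src, hφ, m_comp_map_comp, hT.isAlgebra.assoc, T.map_comp, Strict.assoc]
  · rw [vcomp_src, wr_src, map_src, hφ]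
  · rw [vcomp_tgt hmφ, wl_tgt, wl_tgt, hφ', B.isAlgebra.assoc_comp]
  · rw [wl_src, hl, m_comp_map_comp, (hT.isAlgebra_top hK hu).assoc, T.map_comp, Strict.assoc]
  · rw [vcomp_src, wr_src, map_src, hl]
  · rw [vcomp_tgt hml, wl_tgt, wl_tgt, hl', A.isAlgebra.assoc_comp]
  · rw [wl_wr, hw, wl_wl, wl_wl, T.m_naturality]
  · rw [wr_vcomp hml, wl_vcomp _ hmφ, wr_wr, ← hT.classifies.comm, ← wr_wr, ← map_wr, hw, map_wl,
      wl_wr, wl_wr, hw, wl_wl, wl_wl, ← T.map_comp, ← T.map_comp, hp]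

/-- A classifying map of a strict morphism of algebras carries a lax structure. -/
theorem LiftsClassifier.exists_lax (hK : IsPlumbus K) (hu : S.IsTwoClassifier u)
    (hT : T.LiftsClassifier S u ωp ω) (hΩp : T.IsAlgebra ωp)
    (hp : T.map p ≫ B.str = A.str ≫ p) (h : IsLeftTightPullback p e f u) :
    ∃ (F : LaxHom B ⟨Ω, ω, hT.isAlgebra⟩) (E : LaxHom A ⟨Ωp, ωp, hΩp⟩), F.map = f ∧ E.map = e ∧
      (of E.lax).wr u = (of F.lax).wl (T.map p) := by
  -- The square is the structure square of `p` pasted with its classifying square.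
  obtain ⟨φ, l, hφ, hφ', hl, hl', hw⟩ := hu.exists_cell hK (hT.isLeftTightPullback hK hu h)
    (A.str ≫ e) (B.str ≫ f) (by rw [← Strict.assoc, hp, Strict.assoc, h.comm, Strict.assoc])
  obtain ⟨hi, hi'⟩ := hT.wl_i hK hu h hφ hφ' hl hl' hw
  obtain ⟨hm, hm'⟩ := hT.wl_m hK hu hp h hφ hφ' hl hl' hw
  obtain ⟨F, hF, hF'⟩ := LaxHom.exists_of_cell (B := ⟨Ω, ω, hT.isAlgebra⟩) f φ hφ hφ' hi hm
  obtain ⟨E, hE, hE'⟩ := LaxHom.exists_of_cell (B := ⟨Ωp, ωp, hΩp⟩) e l hl hl' hi' hm'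
  exact ⟨F, E, hF, hE, by rw [hF', hE', hw]⟩

end Classify

/-! ### Lifting classifying squares to lax morphisms. -/

section Pullback

variable {A B P Q : AlgLx T} {p : A.carrier ⟶ B.carrier} {u : P.carrier ⟶ Q.carrier}
  {F : LaxHom B Q} {E : LaxHom A P}

theorem LaxHom.of_lax_ofStrict_comp (hp : T.map p ≫ B.str = A.str ≫ p) (F : LaxHom B Q) :
    of (LaxHom.lax (LaxHom.comp (LaxHom.ofStrict p hp) F)) = (of F.lax).wl (T.map p) := by
  rw [LaxHom.of_lax_comp, LaxHom.of_lax_ofStrict, wr_id]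
  refine vcomp_id ?_
  change T.map p ≫ B.str ≫ F.map = _
  rw [← Strict.assoc, hp]

theorem LaxHom.ofStrict_comp_eq_iff (hp : T.map p ≫ B.str = A.str ≫ p)
    (hu : T.map u ≫ Q.str = P.str ≫ u) (h : p ≫ F.map = E.map ≫ u) :
    (LaxHom.ofStrict p hp).comp F = E.comp (LaxHom.ofStrict u hu) ↔
      (of E.lax).wr u = (of F.lax).wl (T.map p) := by
  rw [← LaxHom.of_lax_ofStrict_comp hp F, ← LaxHom.of_lax_comp_ofStrict hu E]
  exact ⟨fun h => by rw [h], fun h' => LaxHom.ext_of h h'.symm⟩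

theorem LaxHom.ext_of_comp (hpd : IsDiscreteOpfibration p) (hp : T.map p ≫ B.str = A.str ≫ p)
    {Z : AlgLx T} {h k : LaxHom Z A} (hhk : h.map = k.map)
    (hc : h.comp (LaxHom.ofStrict p hp) = k.comp (LaxHom.ofStrict p hp)) : h = k := by
  refine LaxHom.ext_of hhk (hpd.cell_ext ?_ ?_)
  · rw [of_src, of_src, hhk]
  · rw [← LaxHom.of_lax_comp_ofStrict hp, ← LaxHom.of_lax_comp_ofStrict hp, hc]

/-- The laxator of the induced map must be the lift of that of `x` along `p`. Pasted with the
laxator of `E` it lies over the same 2-cell as the laxator of `y`, so the two agree; this also pins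
down its target through the pullback. -/
theorem LaxHom.exists_comp_eq (hp : T.map p ≫ B.str = A.str ≫ p)
    (hu : T.map u ≫ Q.str = P.str ≫ u) (hpd : IsDiscreteOpfibration p)
    (hud : IsDiscreteOpfibration u) (h : IsTwoPullback p E.map F.map u)
    (hw : (of E.lax).wr u = (of F.lax).wl (T.map p)) {Z : AlgLx T} (x : LaxHom Z B)
    (y : LaxHom Z P) (hxy : x.comp F = y.comp (LaxHom.ofStrict u hu)) :
    ∃ k : LaxHom Z A, k.comp (LaxHom.ofStrict p hp) = x ∧ k.comp E = y := by
  have hlax := congrArg (fun g => of (LaxHom.lax g)) hxy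
  rw [LaxHom.of_lax_comp, LaxHom.of_lax_comp_ofStrict hu] at hlax
  obtain ⟨k, hk, hk'⟩ := h.exists_hom x.map y.map (congrArg LaxHom.map hxy)
  obtain ⟨c, hc, hc'⟩ := hpd.exists_lift (T.map k ≫ A.str) (of x.lax) (by
    rw [of_src, Strict.assoc, ← hp, ← Strict.assoc, ← T.map_comp, hk])
  have hm : ((of E.lax).wl (T.map k)).tgt = (c.wr E.map).src := by
    rw [wl_tgt, wr_src, hc, of_tgt, Strict.assoc]
  have hy : (of E.lax).wl (T.map k) ⊚ c.wr E.map = of y.lax := by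
    refine hud.cell_ext ?_ ?_
    · rw [vcomp_src, wl_src, of_src, of_src, ← hk', T.map_comp, Strict.assoc]
    · rw [wr_vcomp hm, wl_wr, hw, wl_wl, ← T.map_comp, hk, wr_wr, ← h.comm, ← wr_wr, hc', hlax]
  have ht : c.tgt = Z.str ≫ k := by
    refine h.hom_ext ?_ ?_
    · rw [Strict.assoc, hk]
      exact congrArg tgt hc'
    · have := congrArg tgt hy
      rw [vcomp_tgt hm] at this
      rw [Strict.assoc, hk']
      exact this
  obtain ⟨H, rfl, hH⟩ := LaxHom.exists_of_comp hpd hp x k hk c hc ht hc'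
  refine ⟨H, LaxHom.ext_of hk ?_, LaxHom.ext_of hk' ?_⟩
  · rw [LaxHom.of_lax_comp_ofStrict hp, hH, hc']
  · rw [LaxHom.of_lax_comp, hH, hy]

theorem isTwoPullback_ofStrict (hp : T.map p ≫ B.str = A.str ≫ p)
    (hu : T.map u ≫ Q.str = P.str ≫ u) (hpd : IsDiscreteOpfibration p)
    (hud : IsDiscreteOpfibration u) (h : IsTwoPullback p E.map F.map u)
    (hw : (of E.lax).wr u = (of F.lax).wl (T.map p)) :
    IsTwoPullback (K := AlgLx T) (P := A) (A := B) (D := P) (C := Q) (LaxHom.ofStrict p hp) E F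
      (LaxHom.ofStrict u hu) := by
  refine isTwoPullback_of_cells (K := AlgLx T) ?_ ?_ ?_
  · exact (LaxHom.ofStrict_comp_eq_iff hp hu h.comm).2 hw
  · intro Z c d hcd
    obtain ⟨χ, hχ, hχ'⟩ := h.exists_cell (forget c) (forget d) (congrArg forget hcd)
    obtain ⟨x, hx, hx'⟩ := LaxHom.exists_comp_eq hp hu hpd hud h hw c.src d.src
      (congrArg src hcd)
    obtain ⟨y, hy, hy'⟩ := LaxHom.exists_comp_eq hp hu hpd hud h hw c.tgt d.tgt
      (congrArg tgt hcd)
    have hχx : χ.src = x.map := by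
      refine h.hom_ext ?_ ?_
      · exact (congrArg src hχ).trans (congrArg LaxHom.map hx).symm
      · exact (congrArg src hχ').trans (congrArg LaxHom.map hx').symm
    have hχy : χ.tgt = y.map := by
      refine h.hom_ext ?_ ?_
      · exact (congrArg tgt hχ).trans (congrArg LaxHom.map hy).symm
      · exact (congrArg tgt hχ').trans (congrArg LaxHom.map hy').symm
    have hc := forget_comm c
    obtain ⟨θ, rfl, rfl, hθ⟩ := exists_forget_eq (A := Z) (B := A) x y χ hχx hχy (by
      have h1 : ((χ.map T.toStrictPseudofunctor).wr A.str).tgt = (of y.lax).src := by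
        rw [wr_tgt, map_tgt, hχy]; rfl
      have h2 : (of x.lax).tgt = (χ.wl Z.str).src := by
        rw [wl_src, hχx]; rfl
      refine hpd.cell_ext ?_ ?_
      · rw [vcomp_src, vcomp_src, wr_src, map_src, hχx]; rfl
      · rw [wr_vcomp h1, wr_vcomp h2, ← LaxHom.of_lax_comp_ofStrict hp,
          ← LaxHom.of_lax_comp_ofStrict hp, hx, hy, wr_wr, ← hp, ← wr_wr, ← map_wr, wl_wr, hχ]
        exact hc)
    refine ⟨θ, forget_ext hx hy ?_, forget_ext hx' hy' ?_⟩
    · rw [forget_wr, hθ]; exact hχ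
    · rw [forget_wr, hθ]; exact hχ'
  · intro Z χ χ' hχ hχ'
    have hf : forget χ = forget χ' :=
      h.cell_ext (congrArg forget hχ) (congrArg forget hχ')
    exact forget_ext (LaxHom.ext_of_comp hpd hp (congrArg src hf) (congrArg src hχ))
      (LaxHom.ext_of_comp hpd hp (congrArg tgt hf) (congrArg tgt hχ)) hf

theorem isLeftTightPullback_ofStrict (hp : T.map p ≫ B.str = A.str ≫ p)
    (hu : T.map u ≫ Q.str = P.str ≫ u) (hpd : IsDiscreteOpfibration p)
    (hud : IsDiscreteOpfibration u) (h : IsLeftTightPullback p E.map F.map u)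
    (hw : (of E.lax).wr u = (of F.lax).wl (T.map p)) :
    IsLeftTightPullback (K := AlgLx T) (P := A) (A := B) (D := P) (C := Q)
      (LaxHom.ofStrict p hp) E F (LaxHom.ofStrict u hu) := by
  refine ⟨isTwoPullback_ofStrict hp hu hpd hud h.toIsTwoPullback hw, ⟨h.tight_left, hp, rfl⟩, ?_⟩
  rintro Z k ⟨hk, hs, hk'⟩
  -- The laxator of `k` lifts the laxator of a strict morphism, which is an identity.
  have key : of (LaxHom.lax k) = of (𝟙 (T.map (LaxHom.map k) ≫ A.str)) := by
    refine hpd.cell_ext rfl ?_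
    rw [← LaxHom.of_lax_comp_ofStrict hp, wr_id]
    refine (congrArg of hk').trans ((of_eqToHom hs).trans ?_)
    change of (𝟙 (T.map (LaxHom.map k ≫ p) ≫ B.str)) = _
    rw [T.map_comp, Strict.assoc, hp, Strict.assoc]
  have hks : T.map (LaxHom.map k) ≫ A.str = Z.str ≫ LaxHom.map k := (congrArg tgt key).symm
  exact ⟨h.detects _ hk, hks, of_inj.1 (key.trans (of_eqToHom hks).symm)⟩

end Pullback

/-! ### Invertible laxators and `T`-cartesian morphisms. -/

section Pseudo

variable {S : PullbackIdeal K} {Ωp Ω : K} {u : Ωp ⟶ Ω} {ωp : T.obj Ωp ⟶ Ωp} {ω : T.obj Ω ⟶ Ω}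
  {A B : AlgLx T} {p : A.carrier ⟶ B.carrier} {e : A.carrier ⟶ Ωp} {f : B.carrier ⟶ Ω}
  {φ : T.map f ≫ ω ⟶ B.str ≫ f} {l : T.map e ≫ ωp ⟶ A.str ≫ e}

/-- If the structure square is a pullback, then `B.str ≫ f` classifies `T p` as well. Two
classifying maps of one morphism are joined by mutually inverse 2-cells. -/
theorem LiftsClassifier.isIso_of_isCartesian (hK : IsPlumbus K) (hu : S.IsTwoClassifier u)
    (hT : T.LiftsClassifier S u ωp ω) (h : IsLeftTightPullback p e f u)
    (hw : (of l).wr u = (of φ).wl (T.map p)) (hc : T.IsCartesian A.str B.str p) : IsIso φ := by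
  have h1 := hT.isLeftTightPullback hK hu h
  have hp := S.pullback _ _ _ _ h hu.small
  have h2 := hc.isTwoPullback (h1.isDiscreteOpfibration hu.isDiscreteOpfibration)
  have h3 := (hu.isLeftTightPullback
    (S.small_of_isTwoPullback hK hp h2 h1.tight_left) h2).paste h.toIsTwoPullback
  obtain ⟨ψ, r, hψ, hψ', hr, hr', hw'⟩ := hu.exists_cell hK h3 _ _ h1.comm
  obtain ⟨ψ, rfl⟩ := ψ.exists_of hψ hψ'
  obtain ⟨r, rfl⟩ := r.exists_of hr hr'
  refine ⟨ψ, of_inj.1 ?_, of_inj.1 ?_⟩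
  · rw [of_comp]
    refine (hu.cell_ext hK h1 (vcomp_src _ _) (of_src (𝟙 _)) (vcomp_tgt (c := of φ) (d := of ψ) rfl)
      (vcomp_src (of l) (of r)) (of_src (𝟙 _)) (vcomp_tgt (c := of l) (d := of r) rfl) ?_ ?_).1
    · rw [wr_vcomp rfl, wl_vcomp _ rfl, hw, hw']
    · rw [wr_id, wl_id, h1.comm]
  · rw [of_comp]
    refine (hu.cell_ext hK h3 (vcomp_src _ _) (of_src (𝟙 _)) (vcomp_tgt (c := of ψ) (d := of φ) rfl)
      (vcomp_src (of r) (of l)) (of_src (𝟙 _)) (vcomp_tgt (c := of r) (d := of l) rfl) ?_ ?_).1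
    · rw [wr_vcomp rfl, wl_vcomp _ rfl, hw, hw']
    · rw [wr_id, wl_id, h3.comm]

theorem LiftsClassifier.isCartesian_of_isIso (hK : IsPlumbus K) (hu : S.IsTwoClassifier u)
    (hT : T.LiftsClassifier S u ωp ω) (hp : T.map p ≫ B.str = A.str ≫ p)
    (h : IsLeftTightPullback p e f u) (hw : (of l).wr u = (of φ).wl (T.map p)) [IsIso φ] :
    T.IsCartesian A.str B.str p := by
  have hud : IsDiscreteOpfibration u := hu.isDiscreteOpfibration
  have h1 := hT.isLeftTightPullback hK hu h
  obtain ⟨P, p', q, hP⟩ := hK.exists_pullback p B.str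
    (S.isTightDiscreteOpfibration p (S.pullback _ _ _ _ h hu.small))
  obtain ⟨d, hd, hd'⟩ := hP.exists_hom (T.map p) A.str hp
  -- The inverse of the comparison `d` is built by transporting `q ≫ e` along `inv φ`: the target of
  -- the lift lies over `T f ≫ ω`, hence defines a map into the pullback `T A`.
  obtain ⟨r, hr, hr'⟩ := hud.exists_lift (q ≫ e) ((of (inv φ)).wl p') (by
    rw [wl_src, of_src, ← Strict.assoc, hP.comm, Strict.assoc, h.comm, Strict.assoc])
  obtain ⟨s, hs, hs'⟩ := h1.exists_hom p' r.tgt (congrArg tgt hr').symm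
  -- The comparison is in fact an isomorphism, so the required 2-isomorphism comes from an equality.
  refine ⟨hp, P, q, p', d, hP.flip, hd', hd, s, ?_, ⟨eqToIso ?_⟩⟩
  · refine hP.hom_ext (by rw [Strict.assoc, hd, hs, Strict.id_comp]) ?_
    rw [Strict.assoc, hd', Strict.id_comp]
    refine h.hom_ext ?_ ?_
    · rw [Strict.assoc, ← hp, ← Strict.assoc, hs, hP.comm]
    · have hm : r.tgt = ((of l).wl s).src := hs'.symm
      have key : r ⊚ (of l).wl s = of (𝟙 (q ≫ e)) := by
        refine hud.cell_ext ((vcomp_src _ _).trans hr) ?_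
        rw [wr_vcomp hm, hr', wl_wr, hw, wl_wl, hs, ← wl_vcomp _ rfl, ← of_comp,
          IsIso.inv_hom_id, wl_id, wr_id, Strict.assoc, ← h.comm, ← Strict.assoc, hP.comm,
          Strict.assoc]
      have := congrArg tgt key
      rw [vcomp_tgt hm, wl_tgt, of_tgt, of_tgt, ← Strict.assoc] at this
      exact this
  · refine h1.hom_ext (by rw [Strict.assoc, hs, hd, Strict.id_comp]) ?_
    rw [Strict.assoc, hs', Strict.id_comp]
    have hm : (of l).tgt = (r.wl d).src := by
      rw [wl_src, hr, ← Strict.assoc, hd', of_tgt]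
    have key : of l ⊚ r.wl d = of (𝟙 (T.map e ≫ ωp)) := by
      refine hud.cell_ext (vcomp_src _ _) ?_
      rw [wr_vcomp hm, hw, wl_wr, hr', wl_wl, hd, ← wl_vcomp _ rfl, ← of_comp,
        IsIso.hom_inv_id, wl_id, wr_id, h1.comm]
    have := congrArg tgt key
    rw [vcomp_tgt hm] at this
    exact this

end Pseudo

end EnhancedTwoMonad

end ClassifyingMaps

/-! ### Assembly of the theorem for the comma object. -/

open EnhancedTwoMonad in
theorem mainTheorem3 {K : Type u} [Bicategory.{w, v} K] [Strict K] [Enhanced K]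
    (hK : IsPlumbus K) (S : PullbackIdeal K) {Ωp Ω : K} (u : Ωp ⟶ Ω) (hu : S.IsTwoClassifier u)
    (T : EnhancedTwoMonad K) (ωp : T.obj Ωp ⟶ Ωp) (ω : T.obj Ω ⟶ Ω)
    (hT : T.LiftsClassifier S u ωp ω)
    (X B : AlgLx T) (b : ColaxHom X B) (C : RepComma b.map) (hC : S.small C.cod) :
    ∃ (hΩp : T.IsAlgebra ωp) (hγ : T.IsAlgebra (b.commaStr C)),
      let algΩp : AlgLx T := ⟨Ωp, ωp, hΩp⟩
      let algΩ : AlgLx T := ⟨Ω, ω, hT.isAlgebra⟩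
      let algC : AlgLx T := ⟨C.pt, b.commaStr C, hγ⟩
      let U : algΩp ⟶ algΩ := LaxHom.ofStrict u hT.classifies.comm
      let D : algC ⟶ B := LaxHom.ofStrict C.cod (b.commaStr_spec C).2.1.symm
      IsTightDiscreteOpfibration D ∧
      ∀ (f : B.carrier ⟶ Ω) (e : C.pt ⟶ Ωp), IsLeftTightPullback C.cod e f u →
        ∃ F : B ⟶ algΩ,
          (LaxHom.map F = f ∧ ∃ E : algC ⟶ algΩp, LaxHom.map E = e ∧ IsLeftTightPullback D E F U) ∧
          (∀ F' : B ⟶ algΩ, (LaxHom.map F' = f ∧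
            ∃ E : algC ⟶ algΩp, LaxHom.map E = e ∧ IsLeftTightPullback D E F' U) → F' = F) ∧
          (LaxHom.IsPseudo F ↔ b.IsCartesianAt) := by
  have hΩp := hT.isAlgebra_top hK hu
  have hp := (b.commaStr_cod C).symm
  obtain ⟨hCt, hCd⟩ := S.isTightDiscreteOpfibration C.cod hC
  have hud : IsDiscreteOpfibration u := hu.isDiscreteOpfibration
  have hγ := b.isAlgebra_commaStr C (hu.detects hC _ (by
    rw [← hp]
    exact Enhanced.tight_comp _ _ (T.map_tight _ hCt) B.isAlgebra.tight))
  refine ⟨hΩp, hγ, ?_⟩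
  intro algΩp algΩ algC U D
  refine ⟨⟨⟨hCt, hp, rfl⟩, isDiscreteOpfibration_ofStrict (E := algC) hCd hp⟩, ?_⟩
  intro f e h
  obtain ⟨F, E, rfl, rfl, hw⟩ := hT.exists_lax (A := algC) hK hu hΩp hp h
  refine ⟨F, ⟨rfl, E, rfl, isLeftTightPullback_ofStrict (A := algC) hp hT.classifies.comm hCd hud h
    hw⟩, ?_, ?_⟩
  · rintro F' ⟨hF, E', hE, h'⟩
    -- Commutativity of the square of lax morphisms says exactly that the two laxators agree over
    -- `u`, which determines them.
    have hw' : (TwoCell.of (LaxHom.lax E')).wr u =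
        (TwoCell.of (LaxHom.lax F')).wl (T.map C.cod) :=
      (LaxHom.ofStrict_comp_eq_iff (A := algC) hp hT.classifies.comm
        (congrArg LaxHom.map h'.comm)).1 h'.comm
    refine LaxHom.ext_of hF (hu.cell_ext hK (hT.isLeftTightPullback hK hu h) ?_ rfl ?_ ?_ rfl ?_
      hw' hw).1
    · rw [TwoCell.of_src, hF]
    · rw [TwoCell.of_tgt, hF]; rfl
    · rw [TwoCell.of_src, hE]
    · rw [TwoCell.of_tgt, hE]; rfl
  · rw [b.isCartesianAt_iff C]
    refine ⟨fun hF => ?_, fun hc => ?_⟩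
    · have : IsIso (LaxHom.lax F) := hF
      exact hT.isCartesian_of_isIso (A := algC) hK hu hp h hw
    · exact hT.isIso_of_isCartesian (A := algC) hK hu h hw hc
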